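/- **Theorem 6.3 (Fractional Hardy inequality).** Let $N\ge 1$ be an integer, $0<s<1$ and $1<p<\infty$ with $sp<N$. For $0<\varrho<1$ put $$\Phi(\varrho)=\mathcal H^{N-2}(\mathbb S^{N-2})\int_{-1}^1\frac{(1-t^2)^{\frac{N-3}{2}}}{(1-2t\varrho+\varrho^2)^{\frac{N+sp}{2}}}\,dt\quad\text{if }N\ge2,\qquad \Phi(\varrho)=(1-\varrho)^{-1-sp}+(1+\varrho)^{-1-sp}\quad\text{if }N=1,$$ where $\mathcal H^{N-2}(\mathbb S^{N-2})$ is the surface area of the unit sphere of $\mathbb R^{N-1}$ (equal to $2$ when $N=2$), and $$C=2\int_0^1\varrho^{sp-1}\Big[1-\varrho^{\frac{N-sp}{p}}\Big]^p\,\Phi(\varrho)\,d\varrho .$$ Then $0<C<\infty$, and with $\beta=(N-sp)/p$ one has, for every $x\in\mathbb R^N$ with $|x|=1$, $$C=C(\beta):=2\lim_{\varepsilon\to0^+}\int_{\{y\in\mathbb R^N:\,||x|-|y||>\varepsilon\}}\frac{\big||x|^{-\beta}-|y|^{-\beta}\big|^{p-2}\big(|x|^{-\beta}-|y|^{-\beta}\big)}{|x-y|^{N+sp}}\,dy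 .$$ Moreover $$C\int_{\mathbb R^N}\frac{|v(x)|^p}{|x|^{sp}}\,dx\le\int_{\mathbb R^N}\int_{\mathbb R^N}\frac{|v(x)-v(y)|^p}{|x-y|^{N+sp}}\,dx\,dy\qquad\text{for all real-valued }v\in C_0^\infty(\mathbb R^N\setminus\{0\}),$$ and $C$ is sharp: if a real number $K$ satisfies this inequality in place of $C$ for all such $v$, then $K\le C$. -/

import Mathlib

open MeasureTheory Filter Topology
open scoped ContDiff ENNReal

noncomputable section

namespace FracHardy

/-- The space `C^∞_0(ℝ^N ∖ {0})`: real-valued smooth functions whose support is compact and does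
not contain the origin (extended by zero to all of `ℝ^N`). -/
def IsTestFunction {N : ℕ} (v : EuclideanSpace ℝ (Fin N) → ℝ) : Prop :=
  ContDiff ℝ ∞ v ∧ HasCompactSupport v ∧ (0 : EuclideanSpace ℝ (Fin N)) ∉ tsupport v

/-- `∫ |v(x)|^p / |x|^{sp} dx`, as an element of `[0, ∞]`. -/
def hardyIntegral {N : ℕ} (s p : ℝ) (v : EuclideanSpace ℝ (Fin N) → ℝ) : ℝ≥0∞ :=
  ∫⁻ x, ENNReal.ofReal (|v x| ^ p / ‖x‖ ^ (s * p))

/-- `∫∫ |v(x) - v(y)|^p / |x - y|^{N + sp} dx dy`, as an element of `[0, ∞]`. -/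
def gagliardoIntegral {N : ℕ} (s p : ℝ) (v : EuclideanSpace ℝ (Fin N) → ℝ) : ℝ≥0∞ :=
  ∫⁻ x, ∫⁻ y, ENNReal.ofReal (|v x - v y| ^ p / ‖x - y‖ ^ ((N : ℝ) + s * p))

/-- The surface area of the unit sphere of `ℝ^d` (it is `2` for `d = 1`). -/
def sphereArea (d : ℕ) : ℝ :=
  (volume : Measure (EuclideanSpace ℝ (Fin d))).toSphere.real Set.univ

/-- The function `Φ` on `(0, 1)`: the integral of `x ↦ |x - ϱ e|^{-(N + sp)}` over the unit sphere
of `ℝ^N`, `e` a unit vector. For `N ≥ 2` it is written as an integral over `t = ⟨x, e⟩`; for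
`N = 1` the sphere is `{1, -1}`. -/
def Phi (N : ℕ) (s p ϱ : ℝ) : ℝ :=
  if N = 1 then
    (1 - ϱ) ^ (-(1 + s * p)) + (1 + ϱ) ^ (-(1 + s * p))
  else
    sphereArea (N - 1) *
      ∫ t in (-1 : ℝ)..1,
        (1 - t ^ 2) ^ (((N : ℝ) - 3) / 2) /
          (1 - 2 * t * ϱ + ϱ ^ 2) ^ (((N : ℝ) + s * p) / 2)

/-- The explicit constant
`2 ∫_0^1 ϱ^{sp - 1} (1 - ϱ^{(N - sp)/p})^p Φ(ϱ) dϱ`. -/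
def hardyConstant (N : ℕ) (s p : ℝ) : ℝ :=
  2 * ∫ ϱ in (0 : ℝ)..1,
    ϱ ^ (s * p - 1) * (1 - ϱ ^ (((N : ℝ) - s * p) / p)) ^ p * Phi N s p ϱ

/-- Twice the integral of
`||x|^{-β} - |y|^{-β}|^{p-2} (|x|^{-β} - |y|^{-β}) / |x - y|^{N + sp}` over the `y` with
`||x| - |y|| > ε`. Its limit as `ε → 0` is the value of the (in general only conditionally
convergent) integral defining `C(β)` when `|x| = 1`. -/
def truncatedC {N : ℕ} (s p β : ℝ) (x : EuclideanSpace ℝ (Fin N)) (ε : ℝ) : ℝ :=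
  2 * ∫ y in {y : EuclideanSpace ℝ (Fin N) | ε < |‖x‖ - ‖y‖|},
    |‖x‖ ^ (-β) - ‖y‖ ^ (-β)| ^ (p - 2) * (‖x‖ ^ (-β) - ‖y‖ ^ (-β)) /
      ‖x - y‖ ^ ((N : ℝ) + s * p)

end FracHardy

end

/-!
Write `σ = s p` and `β = (N - σ)/p`, so that `β p = N - σ`. The function `w = |x|^{-β}` is the
virtual ground state of the inequality, and everything is reduced to integrals on `(0, 1)` in the
variable `ϱ = |y|/|x|`, `|y| < |x|`.

*Reduction to one variable.* Polar coordinates around a unit vector `e`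
(`lintegral_norm_inner_polar`) turn the integral over the sphere of a function of `⟪e, ω⟫` into an
integral against `zonalMeasure N`. Combined with scaling and with the inversion `ϱ ↦ 1/ϱ`, this
computes `∫ F(|y|/|x|) |x - y|^{-(N + σ)} dy` over the interior `|y| < δ |x|` and the exterior
(`setLIntegral_kernel_interior`, `setLIntegral_kernel_exterior`) as `|x|^{-σ}` times an integral
against `radialMeasure N σ`, that is `ϱ^{σ-1} Φ(ϱ) dϱ`. The bound `Φ(ϱ) ≤ D (1 - ϱ)^{-1-σ}`
(`exists_sphereKernel_le`) makes half of the Hardy constant, `J = ∫ (1 - ϱ^β)^p ϱ^{σ-1} Φ(ϱ) dϱ`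
(`radialConstant`), finite since `σ < p`.

*The constant as a principal value.* The integral over `||x| - |y|| > ε` is the exterior weight
`(1 - ϱ^β)^{p-1}` up to `ϱ = 1/(1 + ε)` minus the interior weight `ϱ^β (1 - ϱ^β)^{p-1}` up to
`ϱ = 1 - ε`. On `ϱ < 1 - ε` the difference is `(1 - ϱ^β)^p`; what is left is an interval of length
of order `ε²`, which contributes `O(ε^{p-σ})` (`exists_lintegral_shell_le`).

*The inequality.* Convexity of `t ↦ t^p` gives, for `|y| < |x|`, the discrete Picone inequality
`(1 - ϱ^β)^{p-1} |v(y)|^p ≤ |v(x) - v(y)|^p + (ϱ^{-β} - 1)^{p-1} |v(x)|^p` (`picone`). Integrated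
over the cone `|y| < δ |x|`, `δ < 1`, where all terms are finite, the two outer terms become the
same weights as before times the Hardy integral, and their difference is `∫_{ϱ<δ} (1 - ϱ^β)^p` times
the Hardy integral. The cone and its reflection are disjoint, which gives the factor `2`; then
`δ → 1` (`hardy_inequality`).

*Sharpness.* The trial functions are `|x|^{-β} χ(log |x| / n)`. The same convexity inequality, now
with weights `1 - l` and `l`, separates the variation of `|x|^{-β}`, which yields
`2 (1 - l)^{1-p} J` times the Hardy integral, from that of the cutoff, which is smaller by a factor
of order `n^{-p}` (`gagliardoIntegral_trialFunction_le`). Let `n → ∞` and then `l → 0`.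
-/

noncomputable section

namespace FracHardy

open Set

/-! ### Polar coordinates around an axis -/

section

/-- Polar coordinates for radial functions. -/
theorem lintegral_fun_norm {d : ℕ} (hd : d ≠ 0) {f : ℝ → ℝ≥0∞} (hf : Measurable f) :
    ∫⁻ x : EuclideanSpace ℝ (Fin d), f ‖x‖ =
      ENNReal.ofReal (sphereArea d) * ∫⁻ r in Ioi (0 : ℝ), ENNReal.ofReal (r ^ (d - 1)) * f r := by
  have : Nonempty (Fin d) := ⟨⟨0, Nat.pos_of_ne_zero hd⟩⟩
  set μ : Measure (EuclideanSpace ℝ (Fin d)) := volume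
  have h1 : ∫⁻ x, f ‖x‖ ∂μ =
      ∫⁻ x : ({(0)}ᶜ : Set (EuclideanSpace ℝ (Fin d))), f ‖x.1‖ ∂(μ.comap (↑)) := by
    rw [lintegral_subtype_comap (measurableSet_singleton _).compl fun x ↦ f (‖x‖),
      restrict_compl_singleton]
  have h2 := (μ.measurePreserving_homeomorphUnitSphereProd).lintegral_comp
    (f := fun q : Metric.sphere (0 : EuclideanSpace ℝ (Fin d)) 1 × Ioi (0:ℝ) => f q.2.1)
    (by fun_prop)
  have h3 : ∫⁻ q, f q.2.1 ∂(μ.toSphere.prod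
      (Measure.volumeIoiPow (Module.finrank ℝ (EuclideanSpace ℝ (Fin d)) - 1))) =
      μ.toSphere univ * ∫⁻ r : Ioi (0:ℝ), f r.1 ∂(Measure.volumeIoiPow
        (Module.finrank ℝ (EuclideanSpace ℝ (Fin d)) - 1)) := by
    rw [lintegral_prod _ (by fun_prop)]
    simp [mul_comm]
  rw [h1]
  simp only [homeomorphUnitSphereProd_apply_snd_coe] at h2
  rw [h2, h3]
  congr 1
  · rw [sphereArea, ofReal_measureReal]
  · rw [Measure.volumeIoiPow, lintegral_withDensity_eq_lintegral_mul _ (by fun_prop) (by fun_prop),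
      ← lintegral_subtype_comap measurableSet_Ioi]
    simp

/-- The image of the surface measure of the unit sphere of `ℝ^N` under `ω ↦ ⟪e, ω⟫`, for a unit
vector `e`. For `N ≥ 2` it has the density `|𝕊^{N-2}| (1 - t²)^{(N-3)/2}` on `(-1, 1)`, for `N = 1`
it consists of two unit masses. -/
def zonalMeasure (N : ℕ) : Measure ℝ :=
  if N = 1 then Measure.dirac 1 + Measure.dirac (-1)
  else ENNReal.ofReal (sphereArea (N - 1)) • (volume.restrict (Ioo (-1 : ℝ) 1)).withDensity
    fun t => ENNReal.ofReal ((1 - t ^ 2) ^ (((N : ℝ) - 3) / 2))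

instance sFinite_zonalMeasure (N : ℕ) : SFinite (zonalMeasure N) := by
  unfold zonalMeasure; split_ifs <;> infer_instance

theorem ae_zonalMeasure (N : ℕ) : ∀ᵐ t ∂zonalMeasure N, t ∈ Icc (-1 : ℝ) 1 := by
  unfold zonalMeasure
  split_ifs
  · rw [ae_add_measure_iff]
    constructor <;> simp [ae_dirac_eq]
  · refine Measure.ae_smul_measure ?_ _
    refine (withDensity_absolutelyContinuous _ _).ae_le ?_
    filter_upwards [ae_restrict_mem measurableSet_Ioo] with t ht using Ioo_subset_Icc_self ht

theorem lintegral_zonalMeasure {N : ℕ} (hN : N ≠ 1) {h : ℝ → ℝ≥0∞} (hh : Measurable h) :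
    ∫⁻ t, h t ∂zonalMeasure N = ENNReal.ofReal (sphereArea (N - 1)) *
      ∫⁻ t in Ioo (-1 : ℝ) 1, ENNReal.ofReal ((1 - t ^ 2) ^ (((N : ℝ) - 3) / 2)) * h t := by
  rw [zonalMeasure, if_neg hN, lintegral_smul_measure, smul_eq_mul,
    lintegral_withDensity_eq_lintegral_mul _ (by fun_prop) hh]
  rfl

theorem lintegral_zonalMeasure_one {h : ℝ → ℝ≥0∞} :
    ∫⁻ t, h t ∂zonalMeasure 1 = h 1 + h (-1) := by
  simp [zonalMeasure, lintegral_add_measure]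

/-- Splitting off the first coordinate of `ℝ^{m+1}`. -/
theorem lintegral_norm_coord_zero {m : ℕ} {G : ℝ → ℝ → ℝ≥0∞}
    (hG : Measurable (Function.uncurry G)) :
    ∫⁻ y : EuclideanSpace ℝ (Fin (m + 1)), G ‖y‖ (y 0) =
      ∫⁻ z : ℝ, ∫⁻ u : EuclideanSpace ℝ (Fin m), G (√(z ^ 2 + ‖u‖ ^ 2)) z := by
  have e1 := (PiLp.volume_preserving_toLp (Fin (m + 1))).lintegral_comp
    (f := fun y : EuclideanSpace ℝ (Fin (m + 1)) => G ‖y‖ (y 0))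
    (hG.comp (by fun_prop : Measurable fun y : EuclideanSpace ℝ (Fin (m + 1)) => (‖y‖, y 0)))
  have e2 := (volume_preserving_piFinSuccAbove (fun _ : Fin (m + 1) => ℝ) 0).symm.lintegral_comp
    (f := fun y : (Fin (m + 1) → ℝ) => G ‖WithLp.toLp 2 y‖ (y 0))
    (hG.comp (by fun_prop : Measurable fun y : (Fin (m + 1) → ℝ) => (‖WithLp.toLp 2 y‖, y 0)))
  have hn : ∀ q : ℝ × (Fin m → ℝ),
      ‖(WithLp.toLp 2 ((Fin.insertNthEquiv (fun _ => ℝ) 0) q) :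
        EuclideanSpace ℝ (Fin (m + 1)))‖ =
      √(q.1 ^ 2 + ‖(WithLp.toLp 2 q.2 : EuclideanSpace ℝ (Fin m))‖ ^ 2) := by
    intro q
    rw [EuclideanSpace.norm_eq, EuclideanSpace.norm_eq, Real.sq_sqrt (by positivity)]
    simp [Fin.sum_univ_succ]
  refine e1.symm.trans (e2.symm.trans ?_)
  have hm : Measurable (fun q : ℝ × EuclideanSpace ℝ (Fin m) => G (√(q.1 ^ 2 + ‖q.2‖ ^ 2)) q.1) :=
    hG.comp (by fun_prop : Measurable fun q : ℝ × EuclideanSpace ℝ (Fin m) =>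
      (√(q.1 ^ 2 + ‖q.2‖ ^ 2), q.1))
  simp only [MeasurableEquiv.piFinSuccAbove_symm_apply]
  simp_rw [hn]
  simp only [Fin.insertNthEquiv_apply, Fin.insertNth_apply_same]
  have hm2 : Measurable (fun q : ℝ × (Fin m → ℝ) =>
      G (√(q.1 ^ 2 + ‖(WithLp.toLp 2 q.2 : EuclideanSpace ℝ (Fin m))‖ ^ 2)) q.1) :=
    hG.comp (by fun_prop : Measurable fun q : ℝ × (Fin m → ℝ) =>
      (√(q.1 ^ 2 + ‖(WithLp.toLp 2 q.2 : EuclideanSpace ℝ (Fin m))‖ ^ 2), q.1))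
  have : (volume : Measure (ℝ × (Fin m → ℝ))) = (volume : Measure ℝ).prod volume := rfl
  rw [this, lintegral_prod _ hm2.aemeasurable]
  refine lintegral_congr fun z => ?_
  exact (PiLp.volume_preserving_toLp (Fin m)).lintegral_comp
    (f := fun u : EuclideanSpace ℝ (Fin m) => G (√(z ^ 2 + ‖u‖ ^ 2)) z)
    (hm.comp (by fun_prop : Measurable fun u : EuclideanSpace ℝ (Fin m) => (z, u)))

/-- Any unit vector can be rotated to the first coordinate vector. -/
theorem lintegral_norm_inner {m : ℕ} {G : ℝ → ℝ → ℝ≥0∞}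
    (hG : Measurable (Function.uncurry G)) {e : EuclideanSpace ℝ (Fin (m + 1))} (he : ‖e‖ = 1) :
    ∫⁻ y, G ‖y‖ (inner ℝ e y) = ∫⁻ y : EuclideanSpace ℝ (Fin (m + 1)), G ‖y‖ (y 0) := by
  have hon : Orthonormal ℝ (({0} : Set (Fin (m+1))).domRestrict (fun _ => e)) := by
    rw [orthonormal_iff_ite]
    rintro ⟨i, rfl⟩ ⟨j, rfl⟩
    simp [he]
  obtain ⟨b, hb⟩ := hon.exists_orthonormalBasis_extension_of_card_eq (by simp)
  have hb0 : b 0 = e := hb 0 rfl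
  rw [← (b.repr.measurePreserving).lintegral_comp
    (f := fun y : EuclideanSpace ℝ (Fin (m + 1)) => G ‖y‖ (y 0))
    (hG.comp (by fun_prop : Measurable fun y : EuclideanSpace ℝ (Fin (m + 1)) => (‖y‖, y 0)))]
  simp [b.repr_apply_apply, hb0]

theorem lintegral_even_split {h : ℝ → ℝ≥0∞} (hh : Measurable h) :
    ∫⁻ z, h z = ∫⁻ r in Ioi (0 : ℝ), (h r + h (-r)) := by
  rw [lintegral_add_left (by fun_prop), ← lintegral_add_compl h (measurableSet_Ioi (a := (0:ℝ))),
    compl_Ioi]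
  congr 1
  rw [← (Measure.measurePreserving_neg (volume : Measure ℝ)).setLIntegral_comp_preimage
    measurableSet_Iic hh]
  simp only [neg_preimage, neg_Iic, neg_zero]
  exact setLIntegral_congr Ioi_ae_eq_Ici.symm

/-- The substitution `q = √(r² - z²)` for fixed `z`. -/
theorem lintegral_sqrt_sq_add {m : ℕ} (hm : m ≠ 0) (H : ℝ → ℝ≥0∞) (z : ℝ) :
    ∫⁻ q in Ioi (0 : ℝ), ENNReal.ofReal (q ^ (m - 1)) * H √(z ^ 2 + q ^ 2) =
      ∫⁻ r in Ioi |z|, ENNReal.ofReal (r * (r ^ 2 - z ^ 2) ^ (((m : ℝ) - 2) / 2)) * H r := by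
  have hpos : ∀ r ∈ Ioi |z|, 0 < r ^ 2 - z ^ 2 := by
    intro r hr
    have : |z| ^ 2 < r ^ 2 := pow_lt_pow_left₀ hr (abs_nonneg _) (by norm_num)
    rw [sq_abs] at this
    linarith
  have himg : (fun r => √(r ^ 2 - z ^ 2)) '' Ioi |z| = Ioi 0 := by
    ext q
    constructor
    · rintro ⟨r, hr, rfl⟩
      exact Real.sqrt_pos.2 (hpos r hr)
    · intro hq
      refine ⟨√(z ^ 2 + q ^ 2), ?_, ?_⟩
      · rw [mem_Ioi, Real.lt_sqrt (abs_nonneg _), sq_abs]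
        have : 0 < q ^ 2 := pow_pos hq 2
        linarith
      · simp only
        rw [Real.sq_sqrt (by positivity), add_sub_cancel_left, Real.sqrt_sq (le_of_lt hq)]
  have hinj : InjOn (fun r => √(r ^ 2 - z ^ 2)) (Ioi |z|) := by
    intro r hr r' hr' h
    have h0 : 0 < r := (abs_nonneg z).trans_lt hr
    have h0' : 0 < r' := (abs_nonneg z).trans_lt hr'
    have := (Real.sqrt_inj (hpos r hr).le (hpos r' hr').le).1 h
    exact (pow_left_inj₀ h0.le h0'.le (by norm_num : 2 ≠ 0)).1 (by linarith)
  have hder : ∀ r ∈ Ioi |z|, HasDerivWithinAt (fun r => √(r ^ 2 - z ^ 2)) (r / √(r ^ 2 - z ^ 2))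
      (Ioi |z|) r := by
    intro r hr
    have h1 : HasDerivAt (fun r : ℝ => r ^ 2 - z ^ 2) (2 * r) r := by
      simpa using (hasDerivAt_pow 2 r).sub_const (z ^ 2)
    have := h1.sqrt (hpos r hr).ne'
    refine (this.congr_deriv ?_).hasDerivWithinAt
    rw [mul_div_mul_left _ _ two_ne_zero]
  rw [← himg, lintegral_image_eq_lintegral_abs_deriv_mul measurableSet_Ioi hder hinj]
  refine setLIntegral_congr_fun measurableSet_Ioi fun r hr => ?_
  have h0 : 0 < r := (abs_nonneg z).trans_lt hr
  have hp := hpos r hr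
  have hs : 0 < √(r ^ 2 - z ^ 2) := Real.sqrt_pos.2 hp
  rw [← mul_assoc, ← ENNReal.ofReal_mul (abs_nonneg _), Real.sq_sqrt hp.le, add_sub_cancel,
    Real.sqrt_sq h0.le, abs_of_pos (by positivity)]
  congr 2
  rw [div_mul_eq_mul_div, mul_div_assoc]
  congr 1
  obtain ⟨k, rfl⟩ := Nat.exists_eq_succ_of_ne_zero hm
  rw [Real.sqrt_eq_rpow, ← Real.rpow_natCast, ← Real.rpow_mul hp.le, ← Real.rpow_sub hp]
  congr 1
  simp
  ring

theorem lintegral_Ioo_scale {r : ℝ} (hr : 0 < r) (H : ℝ → ℝ≥0∞) :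
    ∫⁻ z in Ioo (-r) r, H z = ∫⁻ t in Ioo (-1 : ℝ) 1, ENNReal.ofReal r * H (r * t) := by
  have himg : (fun t => r * t) '' Ioo (-1) 1 = Ioo (-r) r := by
    rw [image_mul_left_Ioo hr]; simp
  rw [← himg, lintegral_image_eq_lintegral_abs_deriv_mul (f' := fun _ => r) measurableSet_Ioo
    (fun t _ => by simpa using ((hasDerivAt_id t).const_mul r).hasDerivWithinAt)
    (mul_right_injective₀ hr.ne').injOn, abs_of_pos hr]

/-- Integration of a function of `‖y‖` and `⟪e, y⟫` in polar coordinates. -/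
theorem lintegral_norm_inner_polar {N : ℕ} {G : ℝ → ℝ → ℝ≥0∞}
    (hG : Measurable (Function.uncurry G)) {e : EuclideanSpace ℝ (Fin N)} (he : ‖e‖ = 1) :
    ∫⁻ y, G ‖y‖ (inner ℝ e y) = ∫⁻ r in Ioi (0 : ℝ), ENNReal.ofReal (r ^ (N - 1)) *
      ∫⁻ t, G r (r * t) ∂zonalMeasure N := by
  obtain _ | m := N
  · rw [Subsingleton.elim e 0, norm_zero] at he
    exact absurd he zero_ne_one
  rw [lintegral_norm_inner hG he, lintegral_norm_coord_zero hG]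
  have hGz : ∀ z, Measurable fun r => G r z := fun z =>
    hG.comp (by fun_prop : Measurable fun r : ℝ => (r, z))
  rcases eq_or_ne m 0 with rfl | hm
  · have hv : (volume : Measure (EuclideanSpace ℝ (Fin 0))) univ = 1 := by
      rw [volume_euclideanSpace_eq_dirac]; simp
    have : ∀ (z : ℝ) (u : EuclideanSpace ℝ (Fin 0)), √(z ^ 2 + ‖u‖ ^ 2) = |z| := by
      intro z u
      rw [Subsingleton.elim u 0, norm_zero]
      simp [Real.sqrt_sq_eq_abs]
    simp only [this, lintegral_const, hv, mul_one]
    rw [lintegral_even_split (h := fun z => G |z| z)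
      (hG.comp (by fun_prop : Measurable fun r : ℝ => (|r|, r)))]
    refine setLIntegral_congr_fun measurableSet_Ioi fun r hr => ?_
    have hr' : 0 < r := hr
    simp [lintegral_zonalMeasure_one, abs_of_pos hr']
  have hHm : Measurable fun q : ℝ × ℝ => ENNReal.ofReal
      (q.2 * (q.2 ^ 2 - q.1 ^ 2) ^ (((m : ℝ) - 2) / 2)) * G q.2 q.1 :=
    (by fun_prop : Measurable fun q : ℝ × ℝ => ENNReal.ofReal
      (q.2 * (q.2 ^ 2 - q.1 ^ 2) ^ (((m : ℝ) - 2) / 2))).mul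
      (hG.comp (by fun_prop : Measurable fun q : ℝ × ℝ => (q.2, q.1)))
  have h1 : ∀ z : ℝ, ∫⁻ u : EuclideanSpace ℝ (Fin m), G (√(z ^ 2 + ‖u‖ ^ 2)) z =
      ENNReal.ofReal (sphereArea m) * ∫⁻ r, (Ioi |z|).indicator (fun r => ENNReal.ofReal
        (r * (r ^ 2 - z ^ 2) ^ (((m : ℝ) - 2) / 2)) * G r z) r := by
    intro z
    rw [lintegral_fun_norm hm (f := fun q => G (√(z ^ 2 + q ^ 2)) z)
      ((hGz z).comp (by fun_prop : Measurable fun q : ℝ => √(z ^ 2 + q ^ 2))),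
      lintegral_sqrt_sq_add hm (fun r => G r z), lintegral_indicator measurableSet_Ioi]
  have hind : MeasurableSet {q : ℝ × ℝ | |q.1| < q.2} :=
    measurableSet_lt (by fun_prop) (by fun_prop)
  have hIm : Measurable fun q : ℝ × ℝ => (Ioi |q.1|).indicator (fun r => ENNReal.ofReal
        (r * (r ^ 2 - q.1 ^ 2) ^ (((m : ℝ) - 2) / 2)) * G r q.1) q.2 :=
    hHm.indicator hind
  simp_rw [h1]
  rw [lintegral_const_mul _ (Measurable.lintegral_prod_right hIm),
    lintegral_lintegral_swap hIm.aemeasurable, ← lintegral_const_mul _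
      (Measurable.lintegral_prod_left hIm), ← lintegral_indicator measurableSet_Ioi]
  refine lintegral_congr fun r => ?_
  by_cases hr : 0 < r
  swap
  · rw [indicator_of_notMem (by simpa using hr), mul_eq_zero]
    right
    refine lintegral_eq_zero_of_ae_eq_zero (Eventually.of_forall fun z => ?_)
    exact indicator_of_notMem (by simpa using (not_lt.1 hr).trans (abs_nonneg z)) _
  rw [indicator_of_mem (by simpa using hr), lintegral_zonalMeasure (by simpa using hm)
    (h := fun t => G r (r * t)) (hG.comp (by fun_prop : Measurable fun t : ℝ => (r, r * t)))]
  have h2 : ∀ z : ℝ, (Ioi |z|).indicator (fun r => ENNReal.ofReal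
        (r * (r ^ 2 - z ^ 2) ^ (((m : ℝ) - 2) / 2)) * G r z) r =
      (Ioo (-r) r).indicator (fun z => ENNReal.ofReal
        (r * (r ^ 2 - z ^ 2) ^ (((m : ℝ) - 2) / 2)) * G r z) z := by
    intro z
    simp only [indicator, mem_Ioi, mem_Ioo, abs_lt]
  simp_rw [h2]
  rw [lintegral_indicator measurableSet_Ioo, lintegral_Ioo_scale hr, mul_left_comm,
    ← lintegral_const_mul' (ENNReal.ofReal (r ^ (m + 1 - 1))) _ ENNReal.ofReal_ne_top]
  simp only [add_tsub_cancel_right]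
  congr 1
  refine setLIntegral_congr_fun measurableSet_Ioo fun (t : ℝ) ht => ?_
  have ht' : 0 ≤ 1 - t ^ 2 := by nlinarith [ht.1, ht.2]
  rw [← mul_assoc, ← mul_assoc, ← ENNReal.ofReal_mul hr.le,
    ← ENNReal.ofReal_mul (by positivity)]
  congr 2
  rw [show r ^ 2 - (r * t) ^ 2 = r ^ 2 * (1 - t ^ 2) by ring,
    Real.mul_rpow (by positivity) ht', ← Real.rpow_natCast r 2, ← Real.rpow_mul hr.le,
    ← Real.rpow_natCast r m]
  have : r ^ (m : ℝ) = r * (r * r ^ ((2 : ℕ) * (((m : ℝ) - 2) / 2))) := by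
    rw [show (m : ℝ) = 1 + (1 + (2 : ℕ) * (((m : ℝ) - 2) / 2)) by push_cast; ring,
      Real.rpow_add hr, Real.rpow_add hr, Real.rpow_one]
    congr 4
    push_cast; ring
  rw [this]
  push_cast
  ring_nf

end

/-! ### The kernel on spheres -/

section

/-- The integral of `ω ↦ |e - r ω|^{-(N + σ)}` over the unit sphere of `ℝ^N`, `e` a unit vector. -/
def sphereKernel (N : ℕ) (σ r : ℝ) : ℝ≥0∞ :=
  ∫⁻ t, ENNReal.ofReal ((1 - 2 * t * r + r ^ 2) ^ (-(((N : ℝ) + σ) / 2))) ∂zonalMeasure N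

@[fun_prop]
theorem measurable_sphereKernel (N : ℕ) (σ : ℝ) : Measurable (sphereKernel N σ) := by
  unfold sphereKernel
  exact Measurable.lintegral_prod_right'
    (f := fun q : ℝ × ℝ => ENNReal.ofReal ((1 - 2 * q.2 * q.1 + q.1 ^ 2) ^ (-(((N : ℝ) + σ) / 2))))
    (by fun_prop)

theorem sq_one_sub_le {t r : ℝ} (ht : t ∈ Icc (-1 : ℝ) 1) (hr : 0 ≤ r) :
    (1 - r) ^ 2 ≤ 1 - 2 * t * r + r ^ 2 := by
  nlinarith [mul_nonneg hr (sub_nonneg.2 ht.2)]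

/-- The sphere inversion identity `|e - ω/r| = |e - r ω| / r`, integrated over the sphere. -/
theorem sphereKernel_inv (N : ℕ) (σ : ℝ) {r : ℝ} (hr : 0 < r) :
    sphereKernel N σ r⁻¹ = ENNReal.ofReal (r ^ ((N : ℝ) + σ)) * sphereKernel N σ r := by
  unfold sphereKernel
  rw [← lintegral_const_mul' _ _ ENNReal.ofReal_ne_top]
  refine lintegral_congr_ae ?_
  filter_upwards [ae_zonalMeasure N] with t ht
  have h0 : 0 ≤ 1 - 2 * t * r + r ^ 2 := (sq_nonneg _).trans (sq_one_sub_le ht hr.le)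
  rw [← ENNReal.ofReal_mul (by positivity)]
  congr 1
  rw [show 1 - 2 * t * r⁻¹ + r⁻¹ ^ 2 = (r ^ 2)⁻¹ * (1 - 2 * t * r + r ^ 2) by field_simp; ring,
    Real.mul_rpow (by positivity) h0, Real.inv_rpow (by positivity),
    ← Real.rpow_neg (by positivity),
    ← Real.rpow_natCast, ← Real.rpow_mul hr.le]
  congr 2
  push_cast; ring

theorem lintegral_Ioi_scale {R : ℝ} (hR : 0 < R) (H : ℝ → ℝ≥0∞) :
    ∫⁻ r in Ioi (0 : ℝ), H r = ∫⁻ r in Ioi (0 : ℝ), ENNReal.ofReal R * H (R * r) := by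
  have himg : (fun r => R * r) '' Ioi 0 = Ioi 0 := by
    rw [image_mul_left_Ioi hR]; simp
  nth_rw 1 [← himg]
  rw [lintegral_image_eq_lintegral_abs_deriv_mul (f' := fun _ => R) measurableSet_Ioi
    (fun t _ => by simpa using ((hasDerivAt_id t).const_mul R).hasDerivWithinAt)
    (mul_right_injective₀ hR.ne').injOn, abs_of_pos hR]

theorem lintegral_Ioi_one_inv (H : ℝ → ℝ≥0∞) :
    ∫⁻ r in Ioi (1 : ℝ), H r = ∫⁻ r in Ioo (0 : ℝ) 1, ENNReal.ofReal ((r ^ 2)⁻¹) * H r⁻¹ := by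
  have himg : (fun r : ℝ => r⁻¹) '' Ioo 0 1 = Ioi 1 := by
    rw [image_inv_eq_inv, inv_Ioo_0_left one_pos, inv_one]
  rw [← himg, lintegral_image_eq_lintegral_abs_deriv_mul (f' := fun r => -(r ^ 2)⁻¹)
    measurableSet_Ioo (fun t ht => (hasDerivAt_inv ht.1.ne').hasDerivWithinAt)
    inv_injective.injOn]
  refine setLIntegral_congr_fun measurableSet_Ioo fun r hr => ?_
  simp only [abs_neg]
  rw [abs_of_pos (by have := hr.1; positivity)]

variable {N : ℕ}

/-- Scaling by `|x|` brings the kernel `|x - y|^{-(N + σ)}` to the unit sphere: the integral of a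
function of `|y|/|x|` against it is `|x|^{-σ}` times a one-dimensional integral. -/
theorem lintegral_kernel {σ : ℝ} {x : EuclideanSpace ℝ (Fin N)} (hx : x ≠ 0) {F : ℝ → ℝ≥0∞}
    (hF : Measurable F) :
    ∫⁻ y, F (‖y‖ / ‖x‖) * ENNReal.ofReal ((‖x - y‖ ^ ((N : ℝ) + σ))⁻¹) =
      ENNReal.ofReal (‖x‖ ^ (-σ)) * ∫⁻ r in Ioi (0 : ℝ),
        F r * (ENNReal.ofReal (r ^ ((N : ℝ) - 1)) * sphereKernel N σ r) := by
  have hN : N ≠ 0 := by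
    rintro rfl
    exact hx (Subsingleton.elim _ _)
  set R := ‖x‖ with hRdef
  have hR : 0 < R := norm_pos_iff.2 hx
  set e : EuclideanSpace ℝ (Fin N) := R⁻¹ • x
  have he : ‖e‖ = 1 := by
    rw [norm_smul, norm_inv, norm_norm, inv_mul_cancel₀ hR.ne']
  have hxe : x = R • e := by simp [e, smul_smul, hR.ne']
  set G : ℝ → ℝ → ℝ≥0∞ := fun r z => F (r / R) *
    ENNReal.ofReal ((R ^ 2 - 2 * R * z + r ^ 2) ^ (-(((N : ℝ) + σ) / 2))) with hGdef
  have hG : Measurable (Function.uncurry G) := by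
    simp only [hGdef, Function.uncurry_def]
    fun_prop
  have h1 : ∀ y, F (‖y‖ / R) * ENNReal.ofReal ((‖x - y‖ ^ ((N : ℝ) + σ))⁻¹) =
      G ‖y‖ (inner ℝ e y) := by
    intro y
    simp only [hGdef]
    congr 2
    have : R ^ 2 - 2 * R * inner ℝ e y + ‖y‖ ^ 2 = ‖x - y‖ ^ 2 := by
      have hin : inner ℝ x y = R * inner ℝ e y := by
        rw [← real_inner_smul_left, ← hxe]
      rw [norm_sub_sq_real, hin, ← hRdef]
      ring
    rw [this, ← Real.rpow_natCast, ← Real.rpow_mul (norm_nonneg _), ← Real.rpow_neg (norm_nonneg _)]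
    congr 1
    push_cast; ring
  simp_rw [h1]
  rw [lintegral_norm_inner_polar hG he, lintegral_Ioi_scale hR,
    ← lintegral_const_mul' _ _ ENNReal.ofReal_ne_top]
  refine setLIntegral_congr_fun measurableSet_Ioi fun r hr => ?_
  have hr : 0 < r := hr
  have h2 : ∫⁻ t, G (R * r) (R * r * t) ∂zonalMeasure N =
      F r * (ENNReal.ofReal (R ^ (-((N : ℝ) + σ))) * sphereKernel N σ r) := by
    rw [sphereKernel, ← lintegral_const_mul' _ _ ENNReal.ofReal_ne_top,
      ← lintegral_const_mul _ (by fun_prop)]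
    refine lintegral_congr_ae ?_
    filter_upwards [ae_zonalMeasure N] with t ht
    have h0 : 0 ≤ 1 - 2 * t * r + r ^ 2 := (sq_nonneg _).trans (sq_one_sub_le ht hr.le)
    simp only [hGdef]
    rw [mul_div_cancel_left₀ _ hR.ne', ← ENNReal.ofReal_mul (by positivity)]
    congr 2
    rw [show R ^ 2 - 2 * R * (R * r * t) + (R * r) ^ 2 = R ^ 2 * (1 - 2 * t * r + r ^ 2) by ring,
      Real.mul_rpow (by positivity) h0, ← Real.rpow_natCast, ← Real.rpow_mul hR.le]
    congr 2
    push_cast; ring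
  rw [h2, show ∀ a b c d f : ℝ≥0∞, a * (b * (c * (d * f))) = (a * b * d) * (c * f) by
    intros; ring, show ∀ a b c d : ℝ≥0∞, a * (b * (c * d)) = (a * c) * (b * d) by
    intros; ring]
  congr 1
  rw [← ENNReal.ofReal_mul hR.le, ← ENNReal.ofReal_mul (by positivity),
    ← ENNReal.ofReal_mul (by positivity)]
  congr 1
  have hN1 : ((N - 1 : ℕ) : ℝ) = (N : ℝ) - 1 := by
    rw [Nat.cast_sub (Nat.one_le_iff_ne_zero.2 hN)]; simp
  rw [← Real.rpow_natCast, hN1, Real.mul_rpow hR.le hr.le, ← mul_assoc, mul_right_comm]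
  congr 1
  nth_rw 1 [← Real.rpow_one R]
  rw [← Real.rpow_add hR, ← Real.rpow_add hR]
  congr 1
  ring

theorem lintegral_kernel_interior {σ : ℝ} {x : EuclideanSpace ℝ (Fin N)} (hx : x ≠ 0)
    {F : ℝ → ℝ≥0∞} (hF : Measurable F) :
    ∫⁻ y in {y | ‖y‖ < ‖x‖}, F (‖y‖ / ‖x‖) * ENNReal.ofReal ((‖x - y‖ ^ ((N : ℝ) + σ))⁻¹) =
      ENNReal.ofReal (‖x‖ ^ (-σ)) * ∫⁻ r in Ioo (0 : ℝ) 1,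
        F r * (ENNReal.ofReal (r ^ ((N : ℝ) - 1)) * sphereKernel N σ r) := by
  have hR : 0 < ‖x‖ := norm_pos_iff.2 hx
  have h := lintegral_kernel (σ := σ) hx (hF.indicator (measurableSet_Iio (a := (1:ℝ))))
  rw [← lintegral_indicator (measurableSet_lt (by fun_prop) (by fun_prop))]
  have h1 : ∀ y, {y : EuclideanSpace ℝ (Fin N) | ‖y‖ < ‖x‖}.indicator (fun y => F (‖y‖ / ‖x‖) *
      ENNReal.ofReal ((‖x - y‖ ^ ((N : ℝ) + σ))⁻¹)) y = (Iio (1:ℝ)).indicator F (‖y‖ / ‖x‖) *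
      ENNReal.ofReal ((‖x - y‖ ^ ((N : ℝ) + σ))⁻¹) := by
    intro y
    simp only [indicator, mem_ofPred_eq, mem_Iio, div_lt_one hR]
    split_ifs <;> simp
  simp_rw [h1]
  rw [h, ← Ioi_inter_Iio, inter_comm, ← Measure.restrict_restrict measurableSet_Iio,
    ← lintegral_indicator measurableSet_Iio]
  congr 1
  refine lintegral_congr fun r => ?_
  simp only [indicator]
  split_ifs <;> simp

/-- The exterior of the ball, brought to `(0, 1)` by `sphereKernel_inv`. -/
theorem lintegral_kernel_exterior {σ : ℝ} {x : EuclideanSpace ℝ (Fin N)} (hx : x ≠ 0)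
    {F : ℝ → ℝ≥0∞} (hF : Measurable F) :
    ∫⁻ y in {y | ‖x‖ < ‖y‖}, F (‖x‖ / ‖y‖) * ENNReal.ofReal ((‖x - y‖ ^ ((N : ℝ) + σ))⁻¹) =
      ENNReal.ofReal (‖x‖ ^ (-σ)) * ∫⁻ r in Ioo (0 : ℝ) 1,
        F r * (ENNReal.ofReal (r ^ (σ - 1)) * sphereKernel N σ r) := by
  have hR : 0 < ‖x‖ := norm_pos_iff.2 hx
  have h := lintegral_kernel (σ := σ) hx ((hF.comp measurable_inv).indicator
    (measurableSet_Ioi (a := (1:ℝ))))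
  rw [← lintegral_indicator (measurableSet_lt (by fun_prop) (by fun_prop))]
  have h1 : ∀ y, {y : EuclideanSpace ℝ (Fin N) | ‖x‖ < ‖y‖}.indicator (fun y => F (‖x‖ / ‖y‖) *
      ENNReal.ofReal ((‖x - y‖ ^ ((N : ℝ) + σ))⁻¹)) y =
      (Ioi (1:ℝ)).indicator (F ∘ Inv.inv) (‖y‖ / ‖x‖) *
      ENNReal.ofReal ((‖x - y‖ ^ ((N : ℝ) + σ))⁻¹) := by
    intro y
    simp only [indicator, mem_ofPred_eq, mem_Ioi, one_lt_div hR, Function.comp, inv_div]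
    split_ifs <;> simp
  simp_rw [h1]
  have h2 : ∀ r, (Ioi (1:ℝ)).indicator (F ∘ Inv.inv) r *
      (ENNReal.ofReal (r ^ ((N : ℝ) - 1)) * sphereKernel N σ r) = (Ioi (1:ℝ)).indicator
      (fun r => F r⁻¹ * (ENNReal.ofReal (r ^ ((N : ℝ) - 1)) * sphereKernel N σ r)) r := by
    intro r
    simp only [indicator]
    split_ifs <;> simp
  rw [h]
  simp_rw [h2]
  rw [lintegral_indicator measurableSet_Ioi, Measure.restrict_restrict measurableSet_Ioi,
    inter_eq_left.2 (Ioi_subset_Ioi zero_le_one), lintegral_Ioi_one_inv]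
  congr 1
  refine setLIntegral_congr_fun measurableSet_Ioo fun r hr => ?_
  have hr0 := hr.1
  simp only [inv_inv]
  rw [sphereKernel_inv N σ hr.1, mul_left_comm]
  congr 1
  rw [← mul_assoc, ← mul_assoc, ← ENNReal.ofReal_mul (by positivity),
    ← ENNReal.ofReal_mul (by positivity)]
  congr 2
  rw [Real.inv_rpow hr0.le, ← Real.rpow_neg hr0.le, ← Real.rpow_natCast, ← Real.rpow_neg hr0.le,
    ← Real.rpow_add hr0, ← Real.rpow_add hr0]
  congr 1
  push_cast; ring

theorem exists_norm_eq_one (hN : N ≠ 0) : ∃ e : EuclideanSpace ℝ (Fin N), ‖e‖ = 1 :=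
  ⟨EuclideanSpace.single ⟨0, Nat.pos_of_ne_zero hN⟩ 1, by simp⟩

/-- The total mass is the surface area of the sphere. Its finiteness, which for `N = 2` rests on
the integrability of `(1 - t²)^{-1/2}`, follows from that of the volume of the unit ball. -/
theorem zonalMeasure_univ_ne_top (hN : N ≠ 0) : zonalMeasure N univ ≠ ⊤ := by
  obtain ⟨e, he⟩ := exists_norm_eq_one hN
  have h := lintegral_norm_inner_polar (G := fun r _ => (Iio (1:ℝ)).indicator 1 r)
    (by
      have : Measurable ((Iio (1:ℝ)).indicator (1 : ℝ → ℝ≥0∞)) :=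
        measurable_one.indicator measurableSet_Iio
      exact this.comp measurable_fst) he
  have h1 : ∫⁻ y : EuclideanSpace ℝ (Fin N), (Iio (1:ℝ)).indicator (1 : ℝ → ℝ≥0∞) ‖y‖ =
      volume (Metric.ball (0 : EuclideanSpace ℝ (Fin N)) 1) := by
    rw [← lintegral_indicator_one Metric.isOpen_ball.measurableSet]
    refine lintegral_congr fun y => ?_
    simp [indicator]
  have hm : Measurable fun r : ℝ => ENNReal.ofReal (r ^ (N - 1)) * (Iio (1:ℝ)).indicator 1 r :=
    (by fun_prop : Measurable fun r : ℝ => ENNReal.ofReal (r ^ (N - 1))).mul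
      (measurable_one.indicator measurableSet_Iio)
  simp only [lintegral_const, ← mul_assoc] at h
  rw [h1, lintegral_mul_const _ hm] at h
  have hfin : volume (Metric.ball (0 : EuclideanSpace ℝ (Fin N)) 1) ≠ ⊤ := measure_ball_lt_top.ne
  rw [h] at hfin
  refine (ENNReal.lt_top_of_mul_ne_top_right hfin ?_).ne
  rw [← pos_iff_ne_zero]
  refine lt_of_lt_of_le ?_ (lintegral_mono_set (Ioo_subset_Ioi_self : Ioo (0:ℝ) 1 ⊆ Ioi 0))
  rw [setLIntegral_pos_iff hm]
  have : Function.support (fun r : ℝ => ENNReal.ofReal (r ^ (N - 1)) *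
      (Iio (1:ℝ)).indicator (1 : ℝ → ℝ≥0∞) r) ∩ Ioo 0 1 = Ioo 0 1 := by
    refine inter_eq_right.2 fun r hr => ?_
    have := hr.1
    simp [hr.2, pow_pos this]
  rw [this]
  simp

theorem lintegral_kernel_far {σ δ : ℝ} (hN : N ≠ 0) (hσ : 0 < σ) (hδ : 0 < δ)
    (e : EuclideanSpace ℝ (Fin N)) :
    ∫⁻ y in {y | δ < ‖e - y‖}, ENNReal.ofReal ((‖e - y‖ ^ ((N : ℝ) + σ))⁻¹) =
      ENNReal.ofReal (sphereArea N) * ENNReal.ofReal (δ ^ (-σ) / σ) := by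
  have hm : Measurable ((Ioi δ).indicator fun r : ℝ => ENNReal.ofReal ((r ^ ((N : ℝ) + σ))⁻¹)) :=
    (by fun_prop : Measurable fun r : ℝ => ENNReal.ofReal ((r ^ ((N : ℝ) + σ))⁻¹)).indicator
      measurableSet_Ioi
  rw [← lintegral_indicator (measurableSet_lt (by fun_prop) (by fun_prop))]
  have h1 : ∀ y, {y : EuclideanSpace ℝ (Fin N) | δ < ‖e - y‖}.indicator
      (fun y => ENNReal.ofReal ((‖e - y‖ ^ ((N : ℝ) + σ))⁻¹)) y =
      ((Ioi δ).indicator fun r : ℝ => ENNReal.ofReal ((r ^ ((N : ℝ) + σ))⁻¹)) ‖e - y‖ := by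
    intro y
    simp only [indicator, mem_ofPred_eq, mem_Ioi]
  simp_rw [h1]
  rw [lintegral_sub_left_eq_self (fun y : EuclideanSpace ℝ (Fin N) => ((Ioi δ).indicator
    fun r : ℝ => ENNReal.ofReal ((r ^ ((N : ℝ) + σ))⁻¹)) ‖y‖) e, lintegral_fun_norm hN hm]
  congr 1
  have h2 : ∀ r, ENNReal.ofReal (r ^ (N - 1)) * ((Ioi δ).indicator
      fun r : ℝ => ENNReal.ofReal ((r ^ ((N : ℝ) + σ))⁻¹)) r = (Ioi δ).indicator
      (fun r : ℝ => ENNReal.ofReal (r ^ (-1 - σ))) r := by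
    intro r
    simp only [indicator, mem_Ioi]
    split_ifs with hr
    · have hr0 := hδ.trans hr
      rw [← ENNReal.ofReal_mul (by positivity), ← Real.rpow_natCast, ← Real.rpow_neg hr0.le,
        ← Real.rpow_add hr0, Nat.cast_sub (Nat.one_le_iff_ne_zero.2 hN)]
      congr 2
      push_cast; ring
    · simp
  simp_rw [h2]
  rw [lintegral_indicator measurableSet_Ioi, Measure.restrict_restrict measurableSet_Ioi,
    inter_eq_left.2 (Ioi_subset_Ioi hδ.le), ← ofReal_integral_eq_lintegral_ofReal
    (integrableOn_Ioi_rpow_of_lt (by linarith) hδ)]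
  · rw [integral_Ioi_rpow_of_lt (by linarith) hδ]
    congr 1
    rw [show -1 - σ + 1 = -σ by ring, neg_div_neg_eq]
  · filter_upwards [ae_restrict_mem measurableSet_Ioi] with r hr
    exact Real.rpow_nonneg (hδ.le.trans (le_of_lt hr)) _

/-- Comparison of the kernel at two radii: the distance `|e - ρ' ω|` is at most twice
`|e - ρ ω|`. -/
theorem sphereKernel_le_of_le {σ ρ ρ' : ℝ} (hσ : 0 < σ) (h0 : 0 < ρ') (h1 : ρ' ≤ ρ) (h2 : ρ < 1)
    (h3 : 1 - ρ' ≤ 2 * (1 - ρ)) :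
    sphereKernel N σ ρ ≤ ENNReal.ofReal (4 ^ (((N : ℝ) + σ) / 2)) * sphereKernel N σ ρ' := by
  unfold sphereKernel
  rw [← lintegral_const_mul' _ _ ENNReal.ofReal_ne_top]
  refine lintegral_mono_ae ?_
  filter_upwards [ae_zonalMeasure N] with t ht
  have hq : 0 < ((N : ℝ) + σ) / 2 := by positivity
  rw [← ENNReal.ofReal_mul (by positivity)]
  refine ENNReal.ofReal_le_ofReal ?_
  have hb : 0 < 1 - 2 * t * ρ + ρ ^ 2 :=
    lt_of_lt_of_le (by have : 0 < 1 - ρ := by linarith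
                       positivity) (sq_one_sub_le ht (h0.le.trans h1))
  have hb' : 0 < 1 - 2 * t * ρ' + ρ' ^ 2 :=
    lt_of_lt_of_le (by have : 0 < 1 - ρ' := by linarith
                       positivity) (sq_one_sub_le ht h0.le)
  have hle : 1 - 2 * t * ρ' + ρ' ^ 2 ≤ 4 * (1 - 2 * t * ρ + ρ ^ 2) := by
    have e1 : (1 - ρ') ^ 2 ≤ (2 * (1 - ρ)) ^ 2 := pow_le_pow_left₀ (by linarith) h3 2
    have e2 : ρ' * (1 - t) ≤ ρ * (1 - t) := mul_le_mul_of_nonneg_right h1 (by linarith [ht.2])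
    have e3 : 0 ≤ ρ * (1 - t) := mul_nonneg (h0.le.trans h1) (by linarith [ht.2])
    nlinarith
  rw [Real.rpow_neg hb.le, Real.rpow_neg hb'.le, ← div_eq_mul_inv, inv_eq_one_div,
    div_le_div_iff₀ (by positivity) (by positivity), one_mul,
    ← Real.mul_rpow (by norm_num) hb.le]
  exact Real.rpow_le_rpow hb'.le hle hq.le

/-- The kernel blows up at most like `(1 - ρ)^{-(1 + σ)}` at `1`. Up to a constant its value at `ρ`
is bounded by its mean over `(2ρ - 1, ρ)`, which is an integral over points at distance at
least `1 - ρ` from the unit vector. -/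
theorem exists_sphereKernel_le (hN : N ≠ 0) {σ : ℝ} (hσ : 0 < σ) :
    ∃ D : ℝ, 0 ≤ D ∧ ∀ ρ ∈ Ioo (0 : ℝ) 1,
      sphereKernel N σ ρ ≤ ENNReal.ofReal (D * (1 - ρ) ^ (-1 - σ)) := by
  obtain ⟨e, he⟩ := exists_norm_eq_one hN
  have hex : e ≠ 0 := norm_ne_zero_iff.1 (by rw [he]; exact one_ne_zero)
  set q : ℝ := (N : ℝ) + σ with hq
  have hqpos : 0 < q := by positivity
  set W : ℝ := (zonalMeasure N univ).toReal
  have hA : 0 ≤ sphereArea N := ENNReal.toReal_nonneg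
  have hN1 : (1 : ℝ) ≤ N := by exact_mod_cast Nat.one_le_iff_ne_zero.2 hN
  -- The first summand serves `ρ ≤ 3/4`, where the kernel is bounded, the second `ρ ≥ 3/4`.
  refine ⟨4 ^ q * W + 2 ^ ((N : ℝ) - 1) * (4 ^ (q / 2) * (sphereArea N / σ)), by positivity,
    fun ρ hρ => ?_⟩
  have hd : 0 < 1 - ρ := sub_pos.2 hρ.2
  rcases le_total ρ (3 / 4) with h34 | h34
  · have h1 : sphereKernel N σ ρ ≤ ENNReal.ofReal (4 ^ q * W) := by
      have : ENNReal.ofReal (4 ^ q * W) = ∫⁻ _, ENNReal.ofReal (4 ^ q) ∂zonalMeasure N := by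
        rw [lintegral_const, ENNReal.ofReal_mul (by positivity),
          ENNReal.ofReal_toReal (zonalMeasure_univ_ne_top hN)]
      rw [this]
      refine lintegral_mono_ae ?_
      filter_upwards [ae_zonalMeasure N] with t ht
      refine ENNReal.ofReal_le_ofReal ?_
      have hb : (4⁻¹ : ℝ) ^ 2 ≤ 1 - 2 * t * ρ + ρ ^ 2 :=
        (pow_le_pow_left₀ (by norm_num) (by linarith) 2).trans (sq_one_sub_le ht hρ.1.le)
      refine (Real.rpow_le_rpow_of_nonpos (by positivity) hb (by linarith)).trans ?_
      rw [← Real.rpow_natCast, ← Real.rpow_mul (by norm_num), Real.inv_rpow (by norm_num),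
        ← Real.rpow_neg (by norm_num)]
      refine le_of_eq ?_
      congr 1
      push_cast; ring
    refine h1.trans (ENNReal.ofReal_le_ofReal ?_)
    have h2 : 1 ≤ (1 - ρ) ^ (-1 - σ) :=
      Real.one_le_rpow_of_pos_of_le_one_of_nonpos hd (by linarith [hρ.1]) (by linarith)
    have h3 : 4 ^ q * W ≤ 4 ^ q * W + 2 ^ ((N : ℝ) - 1) * (4 ^ (q / 2) * (sphereArea N / σ)) :=
      le_add_of_nonneg_right (by positivity)
    exact h3.trans (le_mul_of_one_le_right (by positivity) h2)
  · set δ := 1 - ρ with hδ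
    have hIsub : Ioo (1 - 2 * δ) ρ ⊆ Ioo 0 1 := fun r hr => ⟨by linarith [hr.1], by linarith [hr.2]⟩
    have h1 : ENNReal.ofReal (δ * 2 ^ (1 - (N : ℝ))) * sphereKernel N σ ρ ≤
        ENNReal.ofReal (4 ^ (q / 2)) * ∫⁻ r in Ioo (1 - 2 * δ) ρ,
          ENNReal.ofReal (r ^ ((N : ℝ) - 1)) * sphereKernel N σ r := by
      have hc : ∫⁻ _ in Ioo (1 - 2 * δ) ρ, ENNReal.ofReal (2 ^ (1 - (N : ℝ))) * sphereKernel N σ ρ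
          = ENNReal.ofReal (δ * 2 ^ (1 - (N : ℝ))) * sphereKernel N σ ρ := by
        rw [setLIntegral_const, Real.volume_Ioo, ENNReal.ofReal_mul hd.le,
          show ρ - (1 - 2 * δ) = δ by simp only [hδ]; ring]
        ring
      rw [← hc, ← lintegral_const_mul' _ _ ENNReal.ofReal_ne_top]
      refine setLIntegral_mono (by fun_prop) fun r hr => ?_
      rw [mul_left_comm]
      gcongr
      · rw [show 1 - (N : ℝ) = -((N : ℝ) - 1) by ring, Real.rpow_neg (by norm_num),
          ← Real.inv_rpow (by norm_num)]
        exact Real.rpow_le_rpow (by norm_num) (by linarith [hr.1]) (by linarith)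
      · exact sphereKernel_le_of_le hσ (hIsub hr).1 hr.2.le hρ.2 (by linarith [hr.1])
    have h2 : ∫⁻ r in Ioo (1 - 2 * δ) ρ, ENNReal.ofReal (r ^ ((N : ℝ) - 1)) * sphereKernel N σ r ≤
        ENNReal.ofReal (sphereArea N) * ENNReal.ofReal (δ ^ (-σ) / σ) := by
      rw [← lintegral_kernel_far hN hσ hd e]
      have hk := lintegral_kernel (σ := σ) hex
        (F := (Iio ρ).indicator 1) (measurable_one.indicator measurableSet_Iio)
      rw [he] at hk
      simp only [Real.one_rpow, ENNReal.ofReal_one, one_mul, div_one] at hk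
      calc _ ≤ ∫⁻ r in Ioi (0 : ℝ), (Iio ρ).indicator (1 : ℝ → ℝ≥0∞) r *
              (ENNReal.ofReal (r ^ ((N : ℝ) - 1)) * sphereKernel N σ r) := by
            rw [← lintegral_indicator measurableSet_Ioo, ← lintegral_indicator measurableSet_Ioi]
            refine lintegral_mono fun r => ?_
            by_cases hr : r ∈ Ioo (1 - 2 * δ) ρ
            · have h0 : r ∈ Ioi (0:ℝ) := (hIsub hr).1
              have h0' : r ∈ Iio ρ := hr.2
              simp [indicator_of_mem hr, indicator_of_mem h0, indicator_of_mem h0']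
            · simp [indicator_of_notMem hr]
        _ = _ := hk.symm
        _ ≤ _ := by
            rw [← lintegral_indicator (measurableSet_lt (by fun_prop) (by fun_prop))]
            refine lintegral_mono fun y => ?_
            by_cases hy : ‖y‖ < ρ
            -- A point with `‖y‖ < ρ` has distance more than `δ = 1 - ρ` from `e`.
            · have hy' : y ∈ {y | δ < ‖e - y‖} := by
                have := norm_sub_norm_le e y
                rw [he] at this
                simp only [mem_ofPred_eq]
                linarith
              simp [indicator_of_mem hy', hy]
            · simp [hy]
    have h3 : ENNReal.ofReal (δ * 2 ^ (1 - (N : ℝ))) * sphereKernel N σ ρ ≤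
        ENNReal.ofReal (4 ^ (q / 2) * (sphereArea N * (δ ^ (-σ) / σ))) := by
      rw [ENNReal.ofReal_mul (p := 4 ^ (q / 2)) (by positivity), ENNReal.ofReal_mul hA]
      exact h1.trans (by gcongr)
    have hc0 : ENNReal.ofReal (δ * 2 ^ (1 - (N : ℝ))) ≠ 0 := by
      rw [Ne, ENNReal.ofReal_eq_zero, not_le]; positivity
    rw [mul_comm, ← ENNReal.le_div_iff_mul_le (Or.inl hc0) (Or.inl ENNReal.ofReal_ne_top),
      ← ENNReal.ofReal_div_of_pos (by positivity)] at h3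
    refine h3.trans (ENNReal.ofReal_le_ofReal ?_)
    have h4 : 4 ^ (q / 2) * (sphereArea N * (δ ^ (-σ) / σ)) / (δ * 2 ^ (1 - (N : ℝ))) =
        2 ^ ((N : ℝ) - 1) * (4 ^ (q / 2) * (sphereArea N / σ)) * δ ^ (-1 - σ) := by
      rw [show -1 - σ = -σ - 1 by ring, Real.rpow_sub hd, Real.rpow_one,
        show 1 - (N : ℝ) = -((N : ℝ) - 1) by ring, Real.rpow_neg (x := 2) (by norm_num)]
      field_simp
    rw [h4]
    exact mul_le_mul_of_nonneg_right (le_add_of_nonneg_left (by positivity)) (by positivity)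

/-- On `(0, 1)` the function `Φ` is the spherical integral of the kernel. -/
theorem Phi_eq_toReal (hN : N ≠ 0) {s p ρ : ℝ} (hρ : ρ ∈ Ioo (0 : ℝ) 1) :
    Phi N s p ρ = (sphereKernel N (s * p) ρ).toReal := by
  have hd : 0 < 1 - ρ := sub_pos.2 hρ.2
  have hρ0 := hρ.1
  unfold Phi sphereKernel
  split_ifs with h1
  · subst h1
    rw [lintegral_zonalMeasure_one, ENNReal.toReal_add ENNReal.ofReal_ne_top ENNReal.ofReal_ne_top,
      ENNReal.toReal_ofReal, ENNReal.toReal_ofReal]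
    · congr 1
      · rw [show 1 - 2 * 1 * ρ + ρ ^ 2 = (1 - ρ) ^ 2 by ring, ← Real.rpow_natCast,
          ← Real.rpow_mul hd.le]
        congr 1; push_cast; ring
      · rw [show 1 - 2 * (-1) * ρ + ρ ^ 2 = (1 + ρ) ^ 2 by ring, ← Real.rpow_natCast,
          ← Real.rpow_mul (by positivity)]
        congr 1; push_cast; ring
    · rw [show 1 - 2 * (-1) * ρ + ρ ^ 2 = (1 + ρ) ^ 2 by ring]; positivity
    · rw [show 1 - 2 * 1 * ρ + ρ ^ 2 = (1 - ρ) ^ 2 by ring]; positivity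
  · rw [lintegral_zonalMeasure h1 (by fun_prop), ENNReal.toReal_mul,
      ENNReal.toReal_ofReal (show 0 ≤ sphereArea (N - 1) from ENNReal.toReal_nonneg)]
    congr 1
    have hb : ∀ t ∈ Ioo (-1 : ℝ) 1, 0 ≤ 1 - t ^ 2 ∧ 0 ≤ 1 - 2 * t * ρ + ρ ^ 2 := fun t ht =>
      ⟨by nlinarith [ht.1, ht.2],
        (sq_nonneg _).trans (sq_one_sub_le (Ioo_subset_Icc_self ht) hρ0.le)⟩
    rw [intervalIntegral.integral_of_le (by norm_num), integral_Ioc_eq_integral_Ioo,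
      integral_eq_lintegral_of_nonneg_ae]
    · congr 1
      refine setLIntegral_congr_fun measurableSet_Ioo fun t ht => ?_
      obtain ⟨ha, hb⟩ := hb t ht
      rw [← ENNReal.ofReal_mul (by positivity), Real.rpow_neg hb, div_eq_mul_inv]
    · filter_upwards [ae_restrict_mem measurableSet_Ioo] with t ht
      obtain ⟨ha, hb⟩ := hb t ht
      simp only [Pi.zero_apply]
      positivity
    · exact Measurable.aestronglyMeasurable (by fun_prop)

end

/-! ### The radial measure and the constant -/

section

/-- The measure `ϱ^{σ-1} Φ(ϱ) dϱ` on `(0, 1)`. Up to the factor `|x|^{-σ}` it is the image, under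
`y ↦ |x|/|y|`, of the measure `|x - y|^{-(N + σ)} dy` on `{|y| > |x|}`. -/
def radialMeasure (N : ℕ) (σ : ℝ) : Measure ℝ :=
  (volume.restrict (Ioo 0 1)).withDensity
    fun r => ENNReal.ofReal (r ^ (σ - 1)) * sphereKernel N σ r

theorem lintegral_radialMeasure (N : ℕ) (σ : ℝ) {F : ℝ → ℝ≥0∞} (hF : Measurable F) :
    ∫⁻ r, F r ∂radialMeasure N σ = ∫⁻ r in Ioo 0 1,
      F r * (ENNReal.ofReal (r ^ (σ - 1)) * sphereKernel N σ r) := by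
  rw [radialMeasure, lintegral_withDensity_eq_lintegral_mul _ (by fun_prop) hF]
  simp only [Pi.mul_apply, mul_comm]

theorem ae_radialMeasure (N : ℕ) (σ : ℝ) : ∀ᵐ r ∂radialMeasure N σ, r ∈ Ioo (0 : ℝ) 1 :=
  (withDensity_absolutelyContinuous _ _).ae_le (ae_restrict_mem measurableSet_Ioo)

variable {N : ℕ} {σ δ : ℝ}

theorem setLIntegral_kernel_exterior {x : EuclideanSpace ℝ (Fin N)} (hx : x ≠ 0) (hδ : δ ≤ 1)
    {F : ℝ → ℝ≥0∞} (hF : Measurable F) :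
    ∫⁻ y in {y | ‖x‖ < δ * ‖y‖}, F (‖x‖ / ‖y‖) * ENNReal.ofReal ((‖x - y‖ ^ ((N : ℝ) + σ))⁻¹) =
      ENNReal.ofReal (‖x‖ ^ (-σ)) * ∫⁻ r in Iio δ, F r ∂radialMeasure N σ := by
  have hR : 0 < ‖x‖ := norm_pos_iff.2 hx
  have hFi := hF.indicator (measurableSet_Iio (a := δ))
  rw [← lintegral_indicator measurableSet_Iio, lintegral_radialMeasure N σ hFi,
    ← lintegral_kernel_exterior hx hFi,
    ← lintegral_indicator (measurableSet_lt (by fun_prop) (by fun_prop)),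
    ← lintegral_indicator (measurableSet_lt (by fun_prop) (by fun_prop))]
  refine lintegral_congr fun y => ?_
  simp only [indicator, mem_ofPred_eq, mem_Iio]
  by_cases h : ‖x‖ < ‖y‖
  · simp only [h, if_true, div_lt_iff₀ (hR.trans h)]
    split_ifs <;> simp
  · have : ¬ ‖x‖ < δ * ‖y‖ := fun h' => h (h'.trans_le (mul_le_of_le_one_left (norm_nonneg _) hδ))
    simp [h, this]

/-- The interior analogue of `setLIntegral_kernel_exterior`. The extra weight `r^{N-σ}` is the
difference between `r^{N-1}` and the `r^{σ-1}` of the radial measure. -/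
theorem setLIntegral_kernel_interior {x : EuclideanSpace ℝ (Fin N)} (hx : x ≠ 0) (hδ : δ ≤ 1)
    {F : ℝ → ℝ≥0∞} (hF : Measurable F) :
    ∫⁻ y in {y | ‖y‖ < δ * ‖x‖}, F (‖y‖ / ‖x‖) * ENNReal.ofReal ((‖x - y‖ ^ ((N : ℝ) + σ))⁻¹) =
      ENNReal.ofReal (‖x‖ ^ (-σ)) *
        ∫⁻ r in Iio δ, F r * ENNReal.ofReal (r ^ ((N : ℝ) - σ)) ∂radialMeasure N σ := by
  have hR : 0 < ‖x‖ := norm_pos_iff.2 hx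
  have hFi := hF.indicator (measurableSet_Iio (a := δ))
  have h1 : ∀ r, (Iio δ).indicator (fun r => F r * ENNReal.ofReal (r ^ ((N : ℝ) - σ))) r =
      (Iio δ).indicator F r * ENNReal.ofReal (r ^ ((N : ℝ) - σ)) := by
    intro r
    simp only [indicator]
    split_ifs <;> simp
  rw [← lintegral_indicator measurableSet_Iio]
  simp_rw [h1]
  rw [lintegral_radialMeasure N σ (F := fun r => (Iio δ).indicator F r *
    ENNReal.ofReal (r ^ ((N : ℝ) - σ))) (hFi.mul (by fun_prop))]
  have h2 : ∀ r ∈ Ioo (0 : ℝ) 1, (Iio δ).indicator F r * ENNReal.ofReal (r ^ ((N : ℝ) - σ)) *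
      (ENNReal.ofReal (r ^ (σ - 1)) * sphereKernel N σ r) =
      (Iio δ).indicator F r * (ENNReal.ofReal (r ^ ((N : ℝ) - 1)) * sphereKernel N σ r) := by
    intro r hr
    have := hr.1
    rw [mul_assoc, ← mul_assoc (ENNReal.ofReal _), ← ENNReal.ofReal_mul (by positivity),
      ← Real.rpow_add this, sub_add_sub_cancel]
  rw [setLIntegral_congr_fun measurableSet_Ioo h2, ← lintegral_kernel_interior hx hFi,
    ← lintegral_indicator (measurableSet_lt (by fun_prop) (by fun_prop)),
    ← lintegral_indicator (measurableSet_lt (by fun_prop) (by fun_prop))]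
  refine lintegral_congr fun y => ?_
  simp only [indicator, mem_ofPred_eq, mem_Iio]
  by_cases h : ‖y‖ < ‖x‖
  · simp only [h, if_true, div_lt_iff₀ hR]
    split_ifs <;> simp
  · have : ¬ ‖y‖ < δ * ‖x‖ := fun h' => h (h'.trans_le (mul_le_of_le_one_left (norm_nonneg _) hδ))
    simp [h, this]

/-- The condition `a < σ` is for integrability at `0`, the condition `σ < b` for that at `1`. -/
theorem lintegral_radialMeasure_lt_top (hN : N ≠ 0) (hσ : 0 < σ) {a b : ℝ} (ha : a < σ)
    (hb : σ < b) :
    ∫⁻ r, ENNReal.ofReal (r ^ (-a) * (1 - r) ^ b) ∂radialMeasure N σ < ⊤ := by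
  obtain ⟨D, hD, hΨ⟩ := exists_sphereKernel_le hN hσ
  -- The kernel bound reduces the claim to a convergent Beta integral.
  have hbeta := Complex.betaIntegral_convergent (u := ((σ - a : ℝ) : ℂ)) (v := ((b - σ : ℝ) : ℂ))
    (by simpa using ha) (by simpa using hb)
  rw [intervalIntegrable_iff_integrableOn_Ioo_of_le zero_le_one] at hbeta
  have hfin := (hbeta.norm.const_mul D).lintegral_lt_top
  rw [lintegral_radialMeasure N σ (by fun_prop)]
  refine lt_of_le_of_lt (setLIntegral_mono' measurableSet_Ioo fun r hr => ?_) hfin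
  have h0 := hr.1
  have h1 : 0 < 1 - r := sub_pos.2 hr.2
  calc _ ≤ ENNReal.ofReal (r ^ (-a) * (1 - r) ^ b) * (ENNReal.ofReal (r ^ (σ - 1)) *
          ENNReal.ofReal (D * (1 - r) ^ (-1 - σ))) := by gcongr; exact hΨ r hr
    _ = _ := by
      rw [← ENNReal.ofReal_mul (by positivity), ← ENNReal.ofReal_mul (by positivity)]
      congr 1
      rw [norm_mul, ← Complex.ofReal_one, ← Complex.ofReal_sub, ← Complex.ofReal_sub,
        ← Complex.ofReal_sub, Complex.norm_cpow_eq_rpow_re_of_pos h0,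
        Complex.norm_cpow_eq_rpow_re_of_pos h1, Complex.ofReal_re, Complex.ofReal_re,
        show σ - a - 1 = -a + (σ - 1) by ring, show b - σ - 1 = b + (-1 - σ) by ring,
        Real.rpow_add h0, Real.rpow_add h1]
      ring

theorem radialMeasure_Iio_lt_top (hN : N ≠ 0) (hσ : 0 < σ) (hδ : δ < 1) :
    radialMeasure N σ (Iio δ) < ⊤ := by
  have h := lintegral_radialMeasure_lt_top hN hσ (a := 0) (b := σ + 1) hσ (by linarith)
  have h1 : 0 < 1 - δ := sub_pos.2 hδ
  have hc : ENNReal.ofReal ((1 - δ) ^ (σ + 1)) ≠ 0 := by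
    rw [Ne, ENNReal.ofReal_eq_zero, not_le]; positivity
  refine ENNReal.lt_top_of_mul_ne_top_right (a := ENNReal.ofReal ((1 - δ) ^ (σ + 1)))
    (ne_top_of_le_ne_top h.ne ?_) hc
  rw [← setLIntegral_const, ← lintegral_indicator measurableSet_Iio]
  refine lintegral_mono_ae ?_
  filter_upwards [ae_radialMeasure N σ] with r hr
  refine indicator_apply_le' (fun hr' => ?_) (fun _ => zero_le)
  refine ENNReal.ofReal_le_ofReal ?_
  simp only [neg_zero, Real.rpow_zero, one_mul]
  have : r < δ := hr'
  exact Real.rpow_le_rpow h1.le (by linarith) (by linarith)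

theorem one_sub_rpow_le {β r : ℝ} (hr : r ∈ Ioo (0 : ℝ) 1) :
    1 - r ^ β ≤ max 1 β * (1 - r) := by
  have h1 : 0 < 1 - r := sub_pos.2 hr.2
  rcases le_total β 1 with h | h
  · have : r ^ (1 : ℝ) ≤ r ^ β := Real.rpow_le_rpow_of_exponent_ge hr.1 hr.2.le h
    rw [Real.rpow_one] at this
    rw [max_eq_left h]
    linarith
  · have := one_add_mul_self_le_rpow_one_add (s := r - 1) (by linarith [hr.1]) h
    rw [max_eq_right h, add_sub_cancel] at *
    linarith

theorem one_sub_rpow_mem {β r : ℝ} (hβ : 0 < β) (hr : r ∈ Ioo (0 : ℝ) 1) :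
    1 - r ^ β ∈ Ioo (0 : ℝ) 1 :=
  ⟨sub_pos.2 (Real.rpow_lt_one hr.1.le hr.2 hβ), sub_lt_self _ (Real.rpow_pos_of_pos hr.1 _)⟩

/-- Half of the Hardy constant. -/
def radialConstant (N : ℕ) (σ p β : ℝ) : ℝ≥0∞ :=
  ∫⁻ r, ENNReal.ofReal ((1 - r ^ β) ^ p) ∂radialMeasure N σ

theorem radialConstant_lt_top (hN : N ≠ 0) (hσ : 0 < σ) {p β : ℝ} (hp : σ < p) (hβ : 0 < β) :
    radialConstant N σ p β < ⊤ := by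
  have h := lintegral_radialMeasure_lt_top hN hσ (a := 0) (b := p) hσ hp
  have hM : 0 < max 1 β := lt_max_of_lt_left one_pos
  refine lt_of_le_of_lt ?_ (ENNReal.mul_lt_top (a := ENNReal.ofReal ((max 1 β) ^ p))
    ENNReal.ofReal_lt_top h)
  rw [← lintegral_const_mul' _ _ ENNReal.ofReal_ne_top]
  refine lintegral_mono_ae ?_
  filter_upwards [ae_radialMeasure N σ] with r hr
  have h1 : 0 < 1 - r := sub_pos.2 hr.2
  rw [← ENNReal.ofReal_mul (by positivity)]
  refine ENNReal.ofReal_le_ofReal ?_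
  rw [neg_zero, Real.rpow_zero, one_mul, ← Real.mul_rpow hM.le h1.le]
  exact Real.rpow_le_rpow (one_sub_rpow_mem hβ hr).1.le (one_sub_rpow_le hr) (hσ.trans hp).le

/-- Finiteness of the integral that controls the error of a cutoff on a logarithmic scale. -/
theorem lintegral_log_lt_top (hN : N ≠ 0) (hσ : 0 < σ) {p : ℝ} (hp : σ < p) :
    ∫⁻ r, ENNReal.ofReal (|Real.log r| ^ p) ∂radialMeasure N σ < ⊤ := by
  have hp0 : 0 < p := hσ.trans hp
  -- Any exponent `a ≤ 1` with `a p < σ` would do.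
  set a := σ / (2 * p) with hadef
  have ha : 0 < a := by positivity
  have ha1 : a ≤ 1 := by rw [hadef, div_le_one (by positivity)]; linarith
  have hap : a * p = σ / 2 := by rw [hadef]; field_simp
  have h := lintegral_radialMeasure_lt_top hN hσ (a := a * p) (b := p) (by rw [hap]; linarith) hp
  refine lt_of_le_of_lt ?_ (ENNReal.mul_lt_top (a := ENNReal.ofReal (a⁻¹ ^ p))
    ENNReal.ofReal_lt_top h)
  rw [← lintegral_const_mul' _ _ ENNReal.ofReal_ne_top]
  refine lintegral_mono_ae ?_
  filter_upwards [ae_radialMeasure N σ] with r hr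
  have h0 := hr.1
  have h1 : 0 < 1 - r := sub_pos.2 hr.2
  rw [← ENNReal.ofReal_mul (by positivity)]
  refine ENNReal.ofReal_le_ofReal ?_
  rw [← neg_mul, Real.rpow_mul h0.le, ← Real.mul_rpow (by positivity) h1.le,
    ← Real.mul_rpow (by positivity) (by positivity)]
  refine Real.rpow_le_rpow (abs_nonneg _) ?_ hp0.le
  rw [abs_of_neg (Real.log_neg h0 hr.2)]
  -- `log (r^{-a}) ≤ r^{-a} - 1` and `1 - r^a ≤ 1 - r`.
  have h2 : a * -Real.log r ≤ r ^ (-a) - 1 := by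
    have := Real.log_le_sub_one_of_pos (Real.rpow_pos_of_pos h0 (-a))
    rw [Real.log_rpow h0] at this
    linarith
  have h3 : r ^ (-a) - 1 ≤ r ^ (-a) * (1 - r) := by
    have e1 : r ≤ r ^ a := by
      simpa using Real.rpow_le_rpow_of_exponent_ge h0 hr.2.le ha1
    have e2 : r ^ (-a) * r ^ a = 1 := by rw [← Real.rpow_add h0]; simp
    have e3 : r ^ (-a) * r ≤ r ^ (-a) * r ^ a := by gcongr
    nlinarith
  rw [← div_eq_inv_mul, le_div_iff₀ ha]
  linarith

theorem sphereKernel_lt_top (hN : N ≠ 0) (hσ : 0 < σ) {r : ℝ} (hr : r ∈ Ioo (0 : ℝ) 1) :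
    sphereKernel N σ r < ⊤ := by
  obtain ⟨D, -, hΨ⟩ := exists_sphereKernel_le hN hσ
  exact (hΨ r hr).trans_lt ENNReal.ofReal_lt_top

theorem zonalMeasure_ne_zero (hN : N ≠ 0) : zonalMeasure N ≠ 0 := by
  intro h
  obtain ⟨e, he⟩ := exists_norm_eq_one hN
  have h1 := lintegral_norm_inner_polar (G := fun _ _ => 1) (by fun_prop) he
  have : Nonempty (Fin N) := ⟨⟨0, Nat.pos_of_ne_zero hN⟩⟩
  simp [h] at h1

theorem sphereKernel_pos (hN : N ≠ 0) {r : ℝ} (hr : r ∈ Ioo (0 : ℝ) 1) :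
    0 < sphereKernel N σ r := by
  rw [pos_iff_ne_zero, sphereKernel, Ne, lintegral_eq_zero_iff (by fun_prop)]
  intro h
  refine zonalMeasure_ne_zero hN (ae_eq_bot.1 ?_)
  rw [← eventually_false_iff_eq_bot]
  filter_upwards [h, ae_zonalMeasure N] with t h1 ht
  have h2 : 0 < (1 - r) ^ 2 := pow_pos (sub_pos.2 hr.2) 2
  have h3 : 0 < 1 - 2 * t * r + r ^ 2 := h2.trans_le (sq_one_sub_le ht hr.1.le)
  simp only [Pi.zero_apply, ENNReal.ofReal_eq_zero] at h1
  exact absurd h1 (not_le.2 (Real.rpow_pos_of_pos h3 _))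

theorem radialConstant_pos (hN : N ≠ 0) {p β : ℝ} (hβ : 0 < β) : 0 < radialConstant N σ p β := by
  rw [radialConstant, lintegral_radialMeasure N σ (by fun_prop), setLIntegral_pos_iff (by fun_prop),
    inter_eq_right.2]
  · simp
  · intro r hr
    have h0 := hr.1
    have h1 := (one_sub_rpow_mem hβ hr).1
    refine mul_ne_zero ?_ (mul_ne_zero ?_ (sphereKernel_pos hN hr).ne') <;>
    · rw [Ne, ENNReal.ofReal_eq_zero, not_le]; positivity

theorem hardyConstant_eq (hN : N ≠ 0) {s p : ℝ} (hσ : 0 < s * p) (hβ : 0 < ((N : ℝ) - s * p) / p) :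
    hardyConstant N s p = 2 * (radialConstant N (s * p) p (((N : ℝ) - s * p) / p)).toReal := by
  set β := ((N : ℝ) - s * p) / p
  unfold hardyConstant radialConstant
  congr 1
  rw [lintegral_radialMeasure N _ (by fun_prop), intervalIntegral.integral_of_le zero_le_one,
    integral_Ioc_eq_integral_Ioo, setIntegral_congr_fun (g := fun r => r ^ (s * p - 1) *
      (1 - r ^ β) ^ p * (sphereKernel N (s * p) r).toReal) measurableSet_Ioo
      (fun r hr => by simp only [Phi_eq_toReal hN hr, β]), integral_eq_lintegral_of_nonneg_ae]
  · congr 1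
    refine setLIntegral_congr_fun measurableSet_Ioo fun r hr => ?_
    have h0 := hr.1
    have h1 := (one_sub_rpow_mem hβ hr).1
    rw [ENNReal.ofReal_mul (by positivity), ENNReal.ofReal_toReal (sphereKernel_lt_top hN hσ hr).ne,
      ENNReal.ofReal_mul (by positivity)]
    ring
  · filter_upwards [ae_restrict_mem measurableSet_Ioo] with r hr
    have h0 := hr.1
    have h1 := (one_sub_rpow_mem hβ hr).1
    simp only [Pi.zero_apply]
    positivity
  · exact Measurable.aestronglyMeasurable (by fun_prop)

/-- Monotone exhaustion of `(0, 1)` by `(0, 1 - ε)`. -/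
theorem tendsto_setLIntegral_radialMeasure {F : ℝ → ℝ≥0∞} (hF : Measurable F)
    (hfin : ∫⁻ r, F r ∂radialMeasure N σ < ⊤) :
    Tendsto (fun ε : ℝ => ∫⁻ r in Iio (1 - ε), F r ∂radialMeasure N σ) (𝓝[>] 0)
      (𝓝 (∫⁻ r, F r ∂radialMeasure N σ)) := by
  simp_rw [← lintegral_indicator measurableSet_Iio]
  refine tendsto_lintegral_filter_of_dominated_convergence F
    (Eventually.of_forall fun ε => hF.indicator measurableSet_Iio)
    (Eventually.of_forall fun ε => Eventually.of_forall fun r => indicator_le_self _ _ r)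
    hfin.ne ?_
  filter_upwards [ae_radialMeasure N σ] with r hr
  refine tendsto_const_nhds.congr' ?_
  have h1 : 0 < 1 - r := sub_pos.2 hr.2
  filter_upwards [Ioo_mem_nhdsGT h1] with ε hε
  rw [indicator_of_mem]
  exact show r < 1 - ε by linarith [hε.2]

/-- The balance between the three weights that occur on the two sides of `|y| = |x|`. -/
theorem setLIntegral_radial_balance {p β : ℝ} (hβ : 0 < β) (δ : ℝ) :
    ∫⁻ r in Iio δ, ENNReal.ofReal ((1 - r ^ β) ^ (p - 1)) ∂radialMeasure N σ =
      ∫⁻ r in Iio δ, ENNReal.ofReal (r ^ β * (1 - r ^ β) ^ (p - 1)) ∂radialMeasure N σ +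
      ∫⁻ r in Iio δ, ENNReal.ofReal ((1 - r ^ β) ^ p) ∂radialMeasure N σ := by
  rw [← lintegral_add_left (by fun_prop)]
  refine lintegral_congr_ae (ae_restrict_of_ae ?_)
  filter_upwards [ae_radialMeasure N σ] with r hr
  have h0 := hr.1
  have h1 := (one_sub_rpow_mem hβ hr).1
  rw [← ENNReal.ofReal_add (by positivity) (by positivity)]
  congr 1
  nth_rw 3 [show p = (p - 1) + 1 by ring]
  rw [Real.rpow_add_one h1.ne']
  ring

theorem setLIntegral_one_sub_rpow_lt_top (hN : N ≠ 0) (hσ : 0 < σ) {p β : ℝ} (hp : 1 ≤ p)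
    (hβ : 0 < β) (hδ : δ < 1) :
    ∫⁻ r in Iio δ, ENNReal.ofReal ((1 - r ^ β) ^ (p - 1)) ∂radialMeasure N σ < ⊤ := by
  refine lt_of_le_of_lt ?_ (radialMeasure_Iio_lt_top hN hσ hδ)
  rw [← setLIntegral_one]
  refine lintegral_mono_ae (ae_restrict_of_ae ?_)
  filter_upwards [ae_radialMeasure N σ] with r hr
  have h1 := one_sub_rpow_mem hβ hr
  rw [ENNReal.ofReal_le_one]
  exact Real.rpow_le_one h1.1.le h1.2.le (by linarith)

end

/-! ### The constant as a principal value -/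

section

variable {N : ℕ} {σ δ p β : ℝ}

/-- The weight of the interior region, written in terms of `1 - r^β`. -/
theorem interior_weight (hβ : 0 < β) (hβp : β * p = (N : ℝ) - σ) {r : ℝ}
    (hr : r ∈ Ioo (0 : ℝ) 1) :
    (r ^ (-β) - 1) ^ (p - 1) * r ^ ((N : ℝ) - σ) = r ^ β * (1 - r ^ β) ^ (p - 1) := by
  have h0 := hr.1
  have h1 := (one_sub_rpow_mem hβ hr).1
  have h2 : r ^ (-β) - 1 = r ^ (-β) * (1 - r ^ β) := by
    rw [mul_sub, ← Real.rpow_add h0]; simp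
  rw [h2, Real.mul_rpow (by positivity) h1.le, ← Real.rpow_mul h0.le, mul_right_comm,
    ← Real.rpow_add h0, ← hβp]
  congr 2
  ring

theorem abs_rpow_sub_two_mul {u : ℝ} (hu : 0 < u) (p : ℝ) : |u| ^ (p - 2) * u = u ^ (p - 1) := by
  rw [abs_of_pos hu, ← Real.rpow_add_one hu.ne']
  congr 1; ring

theorem setLIntegral_interior_weight (hβ : 0 < β) (hβp : β * p = (N : ℝ) - σ) (δ : ℝ) :
    ∫⁻ r in Iio δ, ENNReal.ofReal ((r ^ (-β) - 1) ^ (p - 1)) * ENNReal.ofReal (r ^ ((N : ℝ) - σ))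
      ∂radialMeasure N σ =
    ∫⁻ r in Iio δ, ENNReal.ofReal (r ^ β * (1 - r ^ β) ^ (p - 1)) ∂radialMeasure N σ := by
  refine lintegral_congr_ae (ae_restrict_of_ae ?_)
  filter_upwards [ae_radialMeasure N σ] with r hr
  have h0 := hr.1
  rw [← ENNReal.ofReal_mul' (by positivity), interior_weight hβ hβp hr]

/-- The truncated integral is positive for `|y| > 1 + ε` and negative for `|y| < 1 - ε`; in the
variables `1/|y|` and `|y|` the two parts are integrals against the radial measure. -/
theorem truncatedC_eq (hN : N ≠ 0) {s : ℝ} (hσ : 0 < s * p) (hp : 1 ≤ p) (hβ : 0 < β)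
    (hβp : β * p = (N : ℝ) - s * p) {x : EuclideanSpace ℝ (Fin N)} (hx : ‖x‖ = 1)
    {ε : ℝ} (hε : ε ∈ Ioo (0 : ℝ) 1) :
    truncatedC s p β x ε = 2 *
      ((∫⁻ r in Iio (1 + ε)⁻¹, ENNReal.ofReal ((1 - r ^ β) ^ (p - 1))
          ∂radialMeasure N (s * p)).toReal -
        (∫⁻ r in Iio (1 - ε), ENNReal.ofReal (r ^ β * (1 - r ^ β) ^ (p - 1))
          ∂radialMeasure N (s * p)).toReal) := by
  have hε0 := hε.1
  have hx0 : x ≠ 0 := norm_ne_zero_iff.1 (by rw [hx]; exact one_ne_zero)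
  have : Nonempty (Fin N) := ⟨⟨0, Nat.pos_of_ne_zero hN⟩⟩
  set E := {y : EuclideanSpace ℝ (Fin N) | ‖x‖ < (1 + ε)⁻¹ * ‖y‖}
  set I := {y : EuclideanSpace ℝ (Fin N) | ‖y‖ < (1 - ε) * ‖x‖}
  have hEm : MeasurableSet E := measurableSet_lt (by fun_prop) (by fun_prop)
  have hIm : MeasurableSet I := measurableSet_lt (by fun_prop) (by fun_prop)
  have hEy : ∀ y, y ∈ E ↔ 1 + ε < ‖y‖ := by
    intro y
    simp only [E, mem_ofPred_eq, hx]
    rw [inv_mul_eq_div, lt_div_iff₀ (by positivity), one_mul]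
  have hIy : ∀ y, y ∈ I ↔ ‖y‖ < 1 - ε := by
    intro y
    simp only [I, mem_ofPred_eq, hx, mul_one]
  -- Here `‖x‖ = 1` enters: the two parts of the domain are cones with ratios `1/(1+ε)`, `1-ε`.
  have hT : {y : EuclideanSpace ℝ (Fin N) | ε < |‖x‖ - ‖y‖|} = E ∪ I := by
    ext y
    rw [mem_union, hEy, hIy, mem_ofPred_eq, hx, lt_abs]
    constructor <;> rintro (h | h)
    · right; linarith
    · left; linarith
    · right; linarith
    · left; linarith
  have hdisj : Disjoint E I := by
    rw [Set.disjoint_left]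
    intro y h1 h2
    rw [hEy] at h1
    rw [hIy] at h2
    linarith
  set h : EuclideanSpace ℝ (Fin N) → ℝ := fun y =>
    |‖x‖ ^ (-β) - ‖y‖ ^ (-β)| ^ (p - 2) * (‖x‖ ^ (-β) - ‖y‖ ^ (-β)) /
      ‖x - y‖ ^ ((N : ℝ) + s * p) with hh
  have hmeas : Measurable h := by
    simp only [hh]
    fun_prop
  have hE : ∀ y ∈ E, 0 ≤ h y ∧ ENNReal.ofReal (h y) =
      ENNReal.ofReal ((1 - (‖x‖ / ‖y‖) ^ β) ^ (p - 1)) *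
        ENNReal.ofReal ((‖x - y‖ ^ ((N : ℝ) + s * p))⁻¹) := by
    intro y hy
    rw [hEy] at hy
    have hy1 : 1 < ‖y‖ := by linarith
    have hy0 : 0 < ‖y‖ := by linarith
    have hu : 0 < 1 - ‖y‖ ^ (-β) :=
      sub_pos.2 (Real.rpow_lt_one_of_one_lt_of_neg hy1 (neg_neg_of_pos hβ))
    have heq : h y = (1 - ‖y‖ ^ (-β)) ^ (p - 1) * (‖x - y‖ ^ ((N : ℝ) + s * p))⁻¹ := by
      simp only [hh, hx, Real.one_rpow]
      rw [abs_rpow_sub_two_mul hu, div_eq_mul_inv]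
    rw [heq]
    refine ⟨by positivity, ?_⟩
    rw [ENNReal.ofReal_mul (by positivity), hx, one_div, Real.inv_rpow hy0.le,
      ← Real.rpow_neg hy0.le]
  have hI : ∀ y ∈ I, y ≠ 0 → 0 ≤ -h y ∧ ENNReal.ofReal (-h y) =
      ENNReal.ofReal (((‖y‖ / ‖x‖) ^ (-β) - 1) ^ (p - 1)) *
        ENNReal.ofReal ((‖x - y‖ ^ ((N : ℝ) + s * p))⁻¹) := by
    intro y hy hy0
    rw [hIy] at hy
    have hy1 : ‖y‖ < 1 := by linarith
    have hy0 : 0 < ‖y‖ := norm_pos_iff.2 hy0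
    have hu : 0 < ‖y‖ ^ (-β) - 1 :=
      sub_pos.2 (Real.one_lt_rpow_of_pos_of_lt_one_of_neg hy0 hy1 (neg_neg_of_pos hβ))
    have heq : -h y = (‖y‖ ^ (-β) - 1) ^ (p - 1) * (‖x - y‖ ^ ((N : ℝ) + s * p))⁻¹ := by
      simp only [hh, hx, Real.one_rpow]
      rw [abs_sub_comm, ← abs_rpow_sub_two_mul hu, div_eq_mul_inv]
      ring
    rw [heq]
    refine ⟨by positivity, ?_⟩
    rw [ENNReal.ofReal_mul (by positivity), hx, div_one]
  have hne : ∀ᵐ y : EuclideanSpace ℝ (Fin N), y ≠ 0 := by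
    rw [ae_iff]; simp
  have hEae : ∀ᵐ y ∂volume.restrict E, 0 ≤ h y := by
    filter_upwards [ae_restrict_mem hEm] with y hy using (hE y hy).1
  have hIae : ∀ᵐ y ∂volume.restrict I, 0 ≤ -h y := by
    filter_upwards [ae_restrict_mem hIm, ae_restrict_of_ae hne] with y hy hy0 using (hI y hy hy0).1
  have hEl : ∫⁻ y in E, ENNReal.ofReal (h y) =
      ∫⁻ r in Iio (1 + ε)⁻¹, ENNReal.ofReal ((1 - r ^ β) ^ (p - 1)) ∂radialMeasure N (s * p) := by
    rw [setLIntegral_congr_fun hEm fun y hy => (hE y hy).2]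
    have := setLIntegral_kernel_exterior (σ := s * p) (δ := (1 + ε)⁻¹) hx0
      (inv_le_one_of_one_le₀ (by linarith)) (F := fun r => ENNReal.ofReal ((1 - r ^ β) ^ (p - 1)))
      (by fun_prop)
    rw [this, hx, Real.one_rpow, ENNReal.ofReal_one, one_mul]
  have hIl : ∫⁻ y in I, ENNReal.ofReal (-h y) =
      ∫⁻ r in Iio (1 - ε), ENNReal.ofReal (r ^ β * (1 - r ^ β) ^ (p - 1))
        ∂radialMeasure N (s * p) := by
    rw [← setLIntegral_interior_weight hβ hβp]
    have := setLIntegral_kernel_interior (σ := s * p) (δ := 1 - ε) hx0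
      (by linarith) (F := fun r => ENNReal.ofReal ((r ^ (-β) - 1) ^ (p - 1))) (by fun_prop)
    rw [show ENNReal.ofReal (‖x‖ ^ (-(s * p))) = 1 by simp [hx], one_mul] at this
    rw [← this]
    refine lintegral_congr_ae ?_
    filter_upwards [ae_restrict_mem hIm, ae_restrict_of_ae hne] with y hy hy0
    rw [(hI y hy hy0).2]
  have hbfin : ∀ d < (1 : ℝ), ∫⁻ r in Iio d, ENNReal.ofReal ((1 - r ^ β) ^ (p - 1))
      ∂radialMeasure N (s * p) < ⊤ := fun d hd =>
    setLIntegral_one_sub_rpow_lt_top hN hσ hp hβ hd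
  have hEint : IntegrableOn h E := by
    refine ⟨hmeas.aestronglyMeasurable, ?_⟩
    rw [hasFiniteIntegral_iff_ofReal hEae, hEl]
    exact hbfin _ (inv_lt_one_of_one_lt₀ (by linarith))
  have hIint : IntegrableOn (fun y => -h y) I := by
    refine ⟨hmeas.neg.aestronglyMeasurable, ?_⟩
    rw [hasFiniteIntegral_iff_ofReal hIae, hIl]
    have := hbfin (1 - ε) (by linarith)
    rw [setLIntegral_radial_balance hβ] at this
    exact (le_self_add).trans_lt this
  have hIint' : IntegrableOn h I := by simpa using hIint.neg
  unfold truncatedC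
  congr 1
  rw [hT, setIntegral_union hdisj hIm hEint hIint', sub_eq_add_neg]
  congr 1
  · rw [integral_eq_lintegral_of_nonneg_ae hEae hmeas.aestronglyMeasurable, hEl]
  · have : ∫ y in I, h y = -∫ y in I, -h y := by rw [integral_neg, neg_neg]
    rw [this, integral_eq_lintegral_of_nonneg_ae hIae hmeas.neg.aestronglyMeasurable, hIl]

/-- The contribution of the thin shell between the radii `1 - ε` and `1/(1 + ε)`, whose width is
of order `ε²`, is of order `ε^{p-σ}`. -/
theorem exists_lintegral_shell_le (hN : N ≠ 0) (hσ : 0 < σ) (hp : 1 ≤ p) (hβ : 0 < β) :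
    ∃ A : ℝ, 0 ≤ A ∧ ∀ ε ∈ Ioo (0 : ℝ) (1 / 2),
      ∫⁻ r in Ico (1 - ε) (1 + ε)⁻¹, ENNReal.ofReal ((1 - r ^ β) ^ (p - 1)) ∂radialMeasure N σ ≤
        ENNReal.ofReal (A * ε ^ (p - σ)) := by
  obtain ⟨D, hD, hΨ⟩ := exists_sphereKernel_le hN hσ
  set M := max 1 β
  have hM : 0 < M := lt_max_of_lt_left one_pos
  refine ⟨M ^ (p - 1) * (2 * (D * 2 ^ (1 + σ))), by positivity, fun ε hε => ?_⟩
  obtain ⟨hε0, hε1⟩ := hε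
  have hinv : (1 + ε)⁻¹ ≤ 1 - ε / 2 := by
    rw [inv_le_iff_one_le_mul₀ (by positivity)]
    nlinarith
  have hsub : Ico (1 - ε) (1 + ε)⁻¹ ⊆ Ioo 0 1 := fun r hr =>
    ⟨by linarith [hr.1], by linarith [hr.2]⟩
  set B : ℝ := M ^ (p - 1) * ε ^ (p - 1) * (2 * (D * (ε / 2) ^ (-1 - σ)))
  have hbound : ∀ r ∈ Ico (1 - ε) (1 + ε)⁻¹, ENNReal.ofReal ((1 - r ^ β) ^ (p - 1)) *
      (ENNReal.ofReal (r ^ (σ - 1)) * sphereKernel N σ r) ≤ ENNReal.ofReal B := by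
    intro r hr
    have hr01 := hsub hr
    have h0 := hr01.1
    have hd : 0 < 1 - r := sub_pos.2 hr01.2
    have e1 : (1 - r ^ β) ^ (p - 1) ≤ M ^ (p - 1) * ε ^ (p - 1) := by
      rw [← Real.mul_rpow hM.le hε0.le]
      refine Real.rpow_le_rpow (one_sub_rpow_mem hβ hr01).1.le
        ((one_sub_rpow_le hr01).trans ?_) (by linarith)
      gcongr
      linarith [hr.1]
    have e2 : r ^ (σ - 1) ≤ 2 := by
      refine (Real.rpow_le_rpow_of_exponent_ge h0 hr01.2.le
        (by linarith : (-1 : ℝ) ≤ σ - 1)).trans ?_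
      rw [Real.rpow_neg_one, inv_le_comm₀ h0 two_pos]
      linarith [hr.1]
    have e3 : (1 - r) ^ (-1 - σ) ≤ (ε / 2) ^ (-1 - σ) :=
      Real.rpow_le_rpow_of_nonpos (by positivity) (by linarith [hr.2]) (by linarith)
    calc _ ≤ ENNReal.ofReal (M ^ (p - 1) * ε ^ (p - 1)) * (ENNReal.ofReal 2 *
            ENNReal.ofReal (D * (ε / 2) ^ (-1 - σ))) := by
          gcongr
          exact (hΨ r hr01).trans (by gcongr)
      _ = _ := by
          rw [← ENNReal.ofReal_mul (by positivity), ← ENNReal.ofReal_mul (by positivity)]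
  have hF : Measurable fun r : ℝ => ENNReal.ofReal ((1 - r ^ β) ^ (p - 1)) := by fun_prop
  rw [← lintegral_indicator measurableSet_Ico,
    lintegral_radialMeasure N σ (hF.indicator measurableSet_Ico)]
  calc _ ≤ ∫⁻ r, (Ico (1 - ε) (1 + ε)⁻¹).indicator (fun _ => ENNReal.ofReal B) r := by
        refine (setLIntegral_le_lintegral _ _).trans (lintegral_mono fun r => ?_)
        by_cases hr : r ∈ Ico (1 - ε) (1 + ε)⁻¹
        · simpa only [indicator_of_mem hr] using hbound r hr
        · simp [indicator_of_notMem hr]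
    _ = ENNReal.ofReal B * ENNReal.ofReal ((1 + ε)⁻¹ - (1 - ε)) := by
        rw [lintegral_indicator measurableSet_Ico, setLIntegral_const, Real.volume_Ico]
    _ ≤ ENNReal.ofReal B * ENNReal.ofReal (ε ^ 2) := by
        gcongr
        rw [sub_le_iff_le_add, inv_le_iff_one_le_mul₀ (by positivity)]
        nlinarith [pow_pos hε0 3]
    _ = _ := by
        rw [← ENNReal.ofReal_mul (by positivity)]
        congr 1
        simp only [B]
        rw [Real.div_rpow hε0.le two_pos.le, show (-1 - σ) = -(1 + σ) by ring,
          Real.rpow_neg two_pos.le, div_inv_eq_mul,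
          show p - σ = (p - 1) + -(1 + σ) + 2 by ring, Real.rpow_add hε0, Real.rpow_add hε0,
          ← Real.rpow_natCast ε 2]
        push_cast
        ring

/-- The truncated integrals converge to twice the radial constant; the shell left over by the
asymmetry of `1 - ε` and `1/(1 + ε)` is negligible because `σ < p`. -/
theorem tendsto_truncatedC (hN : N ≠ 0) {s : ℝ} (hσ : 0 < s * p) (hσp : s * p < p) (hp : 1 ≤ p)
    (hβ : 0 < β) (hβp : β * p = (N : ℝ) - s * p) {x : EuclideanSpace ℝ (Fin N)} (hx : ‖x‖ = 1) :
    Tendsto (truncatedC s p β x) (𝓝[>] 0) (𝓝 (2 * (radialConstant N (s * p) p β).toReal)) := by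
  obtain ⟨A, hA, hshell⟩ := exists_lintegral_shell_le hN hσ hp hβ
  set μ := radialMeasure N (s * p)
  set c : ℝ → ℝ≥0∞ := fun ε => ∫⁻ r in Iio (1 - ε), ENNReal.ofReal ((1 - r ^ β) ^ p) ∂μ
  set e : ℝ → ℝ≥0∞ := fun ε =>
    ∫⁻ r in Ico (1 - ε) (1 + ε)⁻¹, ENNReal.ofReal ((1 - r ^ β) ^ (p - 1)) ∂μ
  have hJ := radialConstant_lt_top hN hσ hσp hβ
  have hc : Tendsto (fun ε => (c ε).toReal) (𝓝[>] 0)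
      (𝓝 (radialConstant N (s * p) p β).toReal) :=
    (ENNReal.tendsto_toReal hJ.ne).comp (tendsto_setLIntegral_radialMeasure (by fun_prop) hJ)
  have hsmall : ∀ᶠ ε : ℝ in 𝓝[>] 0, ε ∈ Ioo (0 : ℝ) (1 / 2) := Ioo_mem_nhdsGT (by norm_num)
  have he : Tendsto (fun ε => (e ε).toReal) (𝓝[>] 0) (𝓝 0) := by
    have hlim : Tendsto (fun ε : ℝ => A * ε ^ (p - s * p)) (𝓝[>] 0) (𝓝 0) := by
      have h1 : Tendsto (fun ε : ℝ => ε ^ (p - s * p)) (𝓝 0) (𝓝 0) := by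
        have := (Real.continuousAt_rpow_const 0 (p - s * p) (Or.inr (by linarith))).tendsto
        rwa [Real.zero_rpow (by linarith)] at this
      simpa using (h1.const_mul A).mono_left nhdsWithin_le_nhds
    refine squeeze_zero' (Eventually.of_forall fun _ => ENNReal.toReal_nonneg) ?_ hlim
    filter_upwards [hsmall] with ε hε
    have hε0 := hε.1
    exact ENNReal.toReal_le_of_le_ofReal (by positivity) (hshell ε hε)
  have hsum := (hc.add he).const_mul 2
  rw [add_zero] at hsum
  refine hsum.congr' ?_
  filter_upwards [hsmall] with ε hε
  have hε0 := hε.1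
  have hle : 1 - ε ≤ (1 + ε)⁻¹ := by
    rw [le_inv_comm₀ (by linarith [hε.2]) (by positivity), le_inv_comm₀ (by positivity)
      (by linarith [hε.2]), ← one_div, le_div_iff₀ (by positivity)]
    nlinarith
  have hlt : (1 + ε)⁻¹ < 1 := inv_lt_one_of_one_lt₀ (by linarith)
  rw [truncatedC_eq hN hσ hp hβ hβp hx ⟨hε0, by linarith [hε.2]⟩]
  have hfin := setLIntegral_one_sub_rpow_lt_top (p := p) hN hσ hp hβ hlt
  have hsplit : ∫⁻ r in Iio (1 + ε)⁻¹, ENNReal.ofReal ((1 - r ^ β) ^ (p - 1)) ∂μ =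
      ∫⁻ r in Iio (1 - ε), ENNReal.ofReal (r ^ β * (1 - r ^ β) ^ (p - 1)) ∂μ + c ε + e ε := by
    rw [← setLIntegral_radial_balance hβ, ← Iio_union_Ico_eq_Iio hle,
      lintegral_union measurableSet_Ico]
    exact Set.disjoint_left.2 fun r h1 h2 => absurd h1 (not_lt.2 h2.1)
  have hfin' := hfin
  rw [hsplit, ENNReal.add_lt_top, ENNReal.add_lt_top] at hfin'
  rw [hsplit, ENNReal.toReal_add (ENNReal.add_lt_top.2 hfin'.1).ne hfin'.2.ne,
    ENNReal.toReal_add hfin'.1.1.ne hfin'.1.2.ne]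
  ring

end

/-! ### The Hardy inequality -/

section

/-- Convexity of `t ↦ t^p`, with weights `1 - l` and `l`. -/
theorem abs_add_rpow_le {p l : ℝ} (hp : 1 ≤ p) (hl : l ∈ Ioo (0 : ℝ) 1) (a b : ℝ) :
    |a + b| ^ p ≤ (1 - l) ^ (1 - p) * |a| ^ p + l ^ (1 - p) * |b| ^ p := by
  have h0 := hl.1
  have h1 : 0 < 1 - l := sub_pos.2 hl.2
  have hscale : ∀ {m c : ℝ}, 0 < m → m * (|c| / m) ^ p = m ^ (1 - p) * |c| ^ p := by
    intro m c hm
    rw [Real.div_rpow (abs_nonneg _) hm.le, Real.rpow_sub hm, Real.rpow_one]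
    ring
  have h := (convexOn_rpow hp).2 (x := |a| / (1 - l)) (y := |b| / l)
    (by simp only [mem_Ici]; positivity) (by simp only [mem_Ici]; positivity) h1.le h0.le
    (sub_add_cancel 1 l)
  simp only [smul_eq_mul] at h
  rw [hscale h1, hscale h0, mul_div_cancel₀ _ h1.ne', mul_div_cancel₀ _ h0.ne'] at h
  exact (Real.rpow_le_rpow (abs_nonneg _) (abs_add_le a b) (by linarith)).trans h

/-- The discrete Picone inequality for `|x|^{-β}`, where `r = |y|/|x|`. -/
theorem picone {p β r : ℝ} (hp : 1 ≤ p) (hβ : 0 < β) (hr : r ∈ Ioo (0 : ℝ) 1) (a b : ℝ) :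
    (1 - r ^ β) ^ (p - 1) * |b| ^ p ≤ |a - b| ^ p + (r ^ (-β) - 1) ^ (p - 1) * |a| ^ p := by
  have h0 := hr.1
  have hu := one_sub_rpow_mem hβ hr
  have ht : r ^ β ∈ Ioo (0 : ℝ) 1 := ⟨by positivity, by linarith [hu.1]⟩
  have h := abs_add_rpow_le hp ht (b - a) a
  rw [sub_add_cancel, abs_sub_comm b a] at h
  have h' := mul_le_mul_of_nonneg_left h (Real.rpow_nonneg hu.1.le (p - 1))
  rw [mul_add, ← mul_assoc, ← mul_assoc, ← Real.rpow_add hu.1] at h'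
  have e1 : (1 - r ^ β) ^ (p - 1 + (1 - p)) = 1 := by
    rw [show p - 1 + (1 - p) = 0 by ring, Real.rpow_zero]
  have e2 : (1 - r ^ β) ^ (p - 1) * (r ^ β) ^ (1 - p) = (r ^ (-β) - 1) ^ (p - 1) := by
    rw [show r ^ (-β) - 1 = (1 - r ^ β) / r ^ β by
        rw [Real.rpow_neg h0.le]; field_simp [ht.1.ne'],
      Real.div_rpow hu.1.le ht.1.le, show 1 - p = -(p - 1) by ring, Real.rpow_neg ht.1.le,
      div_eq_mul_inv]
  rwa [e1, e2, one_mul] at h'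

variable {N : ℕ} {σ δ : ℝ}

theorem ae_ne_zero (hN : N ≠ 0) : ∀ᵐ y : EuclideanSpace ℝ (Fin N), y ≠ 0 := by
  have : Nonempty (Fin N) := ⟨⟨0, Nat.pos_of_ne_zero hN⟩⟩
  rw [ae_iff]; simp

theorem measurable_lintegral_section
    {S : Set (EuclideanSpace ℝ (Fin N) × EuclideanSpace ℝ (Fin N))} (hS : MeasurableSet S)
    {T : EuclideanSpace ℝ (Fin N) → EuclideanSpace ℝ (Fin N) → ℝ≥0∞}
    (hT : Measurable (Function.uncurry T)) :
    Measurable fun x => ∫⁻ y in {y | (x, y) ∈ S}, T x y := by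
  have : ∀ x, ∫⁻ y in {y | (x, y) ∈ S}, T x y = ∫⁻ y, S.indicator (Function.uncurry T) (x, y) := by
    intro x
    rw [← lintegral_indicator (show MeasurableSet {y | (x, y) ∈ S} from measurable_prodMk_left hS)]
    rfl
  simp_rw [this]
  exact Measurable.lintegral_prod_right' (hT.indicator hS)

theorem measurable_lintegral_cone
    {T : EuclideanSpace ℝ (Fin N) → EuclideanSpace ℝ (Fin N) → ℝ≥0∞}
    (hT : Measurable (Function.uncurry T)) (δ : ℝ) :
    Measurable fun x => ∫⁻ y in {y | ‖y‖ < δ * ‖x‖}, T x y :=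
  measurable_lintegral_section (S := {q | ‖q.2‖ < δ * ‖q.1‖})
    (measurableSet_lt (by fun_prop) (by fun_prop)) hT

theorem measurable_lintegral_cone_swap
    {T : EuclideanSpace ℝ (Fin N) → EuclideanSpace ℝ (Fin N) → ℝ≥0∞}
    (hT : Measurable (Function.uncurry T)) (δ : ℝ) :
    Measurable fun x => ∫⁻ y in {y | ‖x‖ < δ * ‖y‖}, T x y :=
  measurable_lintegral_section (S := {q | ‖q.1‖ < δ * ‖q.2‖})
    (measurableSet_lt (by fun_prop) (by fun_prop)) hT

/-- Exchanging the order of integration over the cone `|y| < δ |x|`. -/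
theorem lintegral_cone_swap {g : EuclideanSpace ℝ (Fin N) → EuclideanSpace ℝ (Fin N) → ℝ≥0∞}
    (hg : Measurable (Function.uncurry g)) (δ : ℝ) :
    ∫⁻ x, ∫⁻ y in {y | ‖y‖ < δ * ‖x‖}, g x y = ∫⁻ y, ∫⁻ x in {x | ‖y‖ < δ * ‖x‖}, g x y := by
  have hS : MeasurableSet {q : EuclideanSpace ℝ (Fin N) × EuclideanSpace ℝ (Fin N) |
      ‖q.2‖ < δ * ‖q.1‖} := measurableSet_lt (by fun_prop) (by fun_prop)
  have h1 : ∀ x, ∫⁻ y in {y | ‖y‖ < δ * ‖x‖}, g x y =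
      ∫⁻ y, {q : EuclideanSpace ℝ (Fin N) × EuclideanSpace ℝ (Fin N) |
        ‖q.2‖ < δ * ‖q.1‖}.indicator (Function.uncurry g) (x, y) := by
    intro x
    rw [← lintegral_indicator (measurableSet_lt (by fun_prop) (by fun_prop))]
    rfl
  have h2 : ∀ y, ∫⁻ x in {x | ‖y‖ < δ * ‖x‖}, g x y =
      ∫⁻ x, {q : EuclideanSpace ℝ (Fin N) × EuclideanSpace ℝ (Fin N) |
        ‖q.2‖ < δ * ‖q.1‖}.indicator (Function.uncurry g) (x, y) := by
    intro y
    rw [← lintegral_indicator (measurableSet_lt (by fun_prop) (by fun_prop))]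
    rfl
  simp_rw [h1, h2]
  exact lintegral_lintegral_swap (hg.indicator hS).aemeasurable

/-- Integration over the cone `|y| < δ |x|` with a weight depending on the point of larger norm. -/
theorem lintegral_cone_outer_weight (hN : N ≠ 0) (hδ : δ ≤ 1)
    {w : EuclideanSpace ℝ (Fin N) → ℝ≥0∞} (hw : Measurable w) {F : ℝ → ℝ≥0∞} (hF : Measurable F) :
    ∫⁻ x, ∫⁻ y in {y | ‖y‖ < δ * ‖x‖}, w x *
        (F (‖y‖ / ‖x‖) * ENNReal.ofReal ((‖x - y‖ ^ ((N : ℝ) + σ))⁻¹)) =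
      (∫⁻ x, w x * ENNReal.ofReal (‖x‖ ^ (-σ))) *
        ∫⁻ r in Iio δ, F r * ENNReal.ofReal (r ^ ((N : ℝ) - σ)) ∂radialMeasure N σ := by
  rw [← lintegral_mul_const _ (by fun_prop)]
  refine lintegral_congr_ae ?_
  filter_upwards [ae_ne_zero hN] with x hx
  rw [lintegral_const_mul _ (by fun_prop), setLIntegral_kernel_interior hx hδ hF, mul_assoc]

/-- Integration over the cone `|y| < δ |x|` with a weight depending on the point of smaller norm. -/
theorem lintegral_cone_inner_weight (hN : N ≠ 0) (hδ : δ ≤ 1)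
    {w : EuclideanSpace ℝ (Fin N) → ℝ≥0∞} (hw : Measurable w) {F : ℝ → ℝ≥0∞} (hF : Measurable F) :
    ∫⁻ x, ∫⁻ y in {y | ‖y‖ < δ * ‖x‖}, w y *
        (F (‖y‖ / ‖x‖) * ENNReal.ofReal ((‖x - y‖ ^ ((N : ℝ) + σ))⁻¹)) =
      (∫⁻ y, w y * ENNReal.ofReal (‖y‖ ^ (-σ))) * ∫⁻ r in Iio δ, F r ∂radialMeasure N σ := by
  rw [lintegral_cone_swap (by simp only [Function.uncurry_def]; fun_prop),
    ← lintegral_mul_const _ (by fun_prop)]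
  refine lintegral_congr_ae ?_
  filter_upwards [ae_ne_zero hN] with y hy
  simp_rw [norm_sub_rev _ y]
  rw [lintegral_const_mul _ (by fun_prop), setLIntegral_kernel_exterior hy hδ hF, mul_assoc]

theorem measurable_gagliardo_integrand {v : EuclideanSpace ℝ (Fin N) → ℝ} (hv : Measurable v)
    (p q : ℝ) : Measurable (Function.uncurry fun x y : EuclideanSpace ℝ (Fin N) =>
      ENNReal.ofReal (|v x - v y| ^ p / ‖x - y‖ ^ q)) := by
  simp only [Function.uncurry_def]
  fun_prop

theorem lintegral_cone_gagliardo_swap {v : EuclideanSpace ℝ (Fin N) → ℝ} (hv : Measurable v)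
    (p q δ : ℝ) :
    ∫⁻ x, ∫⁻ y in {y | ‖x‖ < δ * ‖y‖}, ENNReal.ofReal (|v x - v y| ^ p / ‖x - y‖ ^ q) =
      ∫⁻ x, ∫⁻ y in {y | ‖y‖ < δ * ‖x‖}, ENNReal.ofReal (|v x - v y| ^ p / ‖x - y‖ ^ q) := by
  rw [lintegral_cone_swap (measurable_gagliardo_integrand hv p q)]
  simp_rw [fun x y => abs_sub_comm (v x) (v y), fun x y => norm_sub_rev x y]

/-- The cone `|y| < δ |x|` and its reflection are disjoint, and the integrand is symmetric. -/
theorem two_mul_lintegral_cone_le {v : EuclideanSpace ℝ (Fin N) → ℝ} (hv : Measurable v)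
    (s p : ℝ) (hδ : δ ≤ 1) :
    2 * ∫⁻ x, ∫⁻ y in {y | ‖y‖ < δ * ‖x‖},
        ENNReal.ofReal (|v x - v y| ^ p / ‖x - y‖ ^ ((N : ℝ) + s * p)) ≤
      gagliardoIntegral s p v := by
  have hg := measurable_gagliardo_integrand hv p ((N : ℝ) + s * p)
  rw [two_mul]
  nth_rw 1 [← lintegral_cone_gagliardo_swap hv]
  rw [← lintegral_add_left (measurable_lintegral_cone_swap hg δ)]
  refine lintegral_mono fun x => ?_
  rw [← lintegral_union (measurableSet_lt (by fun_prop) (by fun_prop))]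
  · exact setLIntegral_le_lintegral _ _
  · refine Set.disjoint_left.2 fun y (h1 : ‖x‖ < δ * ‖y‖) (h2 : ‖y‖ < δ * ‖x‖) => ?_
    have h3 : δ * ‖y‖ ≤ ‖y‖ := mul_le_of_le_one_left (norm_nonneg _) hδ
    have h4 : δ * ‖x‖ ≤ ‖x‖ := mul_le_of_le_one_left (norm_nonneg _) hδ
    linarith

theorem hardyIntegral_eq {s p : ℝ} (v : EuclideanSpace ℝ (Fin N) → ℝ) :
    hardyIntegral s p v =
      ∫⁻ x, ENNReal.ofReal (|v x| ^ p) * ENNReal.ofReal (‖x‖ ^ (-(s * p))) := by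
  refine lintegral_congr fun x => ?_
  rw [← ENNReal.ofReal_mul (by positivity), Real.rpow_neg (norm_nonneg _), div_eq_mul_inv]

/-- The support of a test function stays away from the singularity of the weight. -/
theorem IsTestFunction.hardyIntegral_lt_top {s p : ℝ} (hp : 0 < p) (hσ : 0 ≤ s * p)
    {v : EuclideanSpace ℝ (Fin N) → ℝ} (hv : IsTestFunction v) : hardyIntegral s p v < ⊤ := by
  obtain ⟨hsm, hc, h0⟩ := hv
  obtain ⟨ρ, hρ, hball⟩ := Metric.isOpen_iff.1 (isClosed_tsupport v).isOpen_compl 0 h0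
  have hint : Integrable fun x => |v x| ^ p := by
    refine Continuous.integrable_of_hasCompactSupport
      (hsm.continuous.abs.rpow_const fun _ => Or.inr hp.le) ?_
    exact hc.comp_left (g := fun t : ℝ => |t| ^ p) (by simp [hp.ne'])
  rw [hardyIntegral_eq]
  refine lt_of_le_of_lt ?_ (ENNReal.mul_lt_top hint.lintegral_lt_top
    (ENNReal.ofReal_lt_top (r := ρ ^ (-(s * p)))))
  rw [← lintegral_mul_const' _ _ ENNReal.ofReal_ne_top]
  refine lintegral_mono fun x => ?_
  by_cases hx : x ∈ tsupport v
  · have : ρ ≤ ‖x‖ := by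
      by_contra hlt
      exact hball (by simpa using not_le.1 hlt) hx
    refine mul_le_mul' le_rfl (ENNReal.ofReal_le_ofReal ?_)
    exact Real.rpow_le_rpow_of_nonpos hρ this (by linarith)
  · simp [image_eq_zero_of_notMem_tsupport hx, hp.ne']

/-- The Picone inequality integrated over the cone `|y| < δ |x|`. The truncation makes the two
integrals that are subtracted from one another finite. -/
theorem truncated_hardy (hN : N ≠ 0) {s p β : ℝ} (hσ : 0 < s * p) (hp : 1 ≤ p) (hβ : 0 < β)
    (hβp : β * p = (N : ℝ) - s * p) {v : EuclideanSpace ℝ (Fin N) → ℝ} (hv : IsTestFunction v)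
    (hδ : δ < 1) :
    2 * (∫⁻ r in Iio δ, ENNReal.ofReal ((1 - r ^ β) ^ p) ∂radialMeasure N (s * p)) *
      hardyIntegral s p v ≤ gagliardoIntegral s p v := by
  have hvm : Measurable v := hv.1.continuous.measurable
  have hH := hv.hardyIntegral_lt_top (s := s) (p := p) (by linarith) hσ.le
  set H := hardyIntegral s p v
  set I := ∫⁻ x, ∫⁻ y in {y | ‖y‖ < δ * ‖x‖},
        ENNReal.ofReal (|v x - v y| ^ p / ‖x - y‖ ^ ((N : ℝ) + s * p))
  have hw : Measurable fun x => ENNReal.ofReal (|v x| ^ p) := by fun_prop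
  have h1 := lintegral_cone_inner_weight (σ := s * p) hN hδ.le hw
    (F := fun r => ENNReal.ofReal ((1 - r ^ β) ^ (p - 1))) (by fun_prop)
  have h2 := lintegral_cone_outer_weight (σ := s * p) hN hδ.le hw
    (F := fun r => ENNReal.ofReal ((r ^ (-β) - 1) ^ (p - 1))) (by fun_prop)
  rw [← hardyIntegral_eq] at h1 h2
  rw [setLIntegral_interior_weight hβ hβp] at h2
  have h3 : H * ∫⁻ r in Iio δ, ENNReal.ofReal ((1 - r ^ β) ^ (p - 1)) ∂radialMeasure N (s * p) ≤
      H * ∫⁻ r in Iio δ, ENNReal.ofReal (r ^ β * (1 - r ^ β) ^ (p - 1)) ∂radialMeasure N (s * p)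
        + I := by
    rw [← h1, ← h2, ← lintegral_add_left' ?_]
    · refine lintegral_mono_ae ?_
      filter_upwards [ae_ne_zero hN] with x hx
      rw [← lintegral_add_left (by fun_prop)]
      refine lintegral_mono_ae ?_
      filter_upwards [ae_restrict_mem (measurableSet_lt (by fun_prop) (by fun_prop)),
        ae_restrict_of_ae (ae_ne_zero hN)] with y (hy : ‖y‖ < δ * ‖x‖) hy0
      have hx0 : 0 < ‖x‖ := norm_pos_iff.2 hx
      have hy0 : 0 < ‖y‖ := norm_pos_iff.2 hy0
      have hr : ‖y‖ / ‖x‖ ∈ Ioo (0 : ℝ) 1 := by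
        refine ⟨by positivity, (div_lt_one hx0).2 (hy.trans ?_)⟩
        exact mul_lt_of_lt_one_left hx0 hδ
      have hu := (one_sub_rpow_mem hβ hr).1
      have hu' : 0 ≤ (‖y‖ / ‖x‖) ^ (-β) - 1 := by
        have := Real.one_lt_rpow_of_pos_of_lt_one_of_neg hr.1 hr.2 (neg_neg_of_pos hβ)
        linarith
      rw [← ENNReal.ofReal_mul (by positivity), ← ENNReal.ofReal_mul (by positivity),
        ← ENNReal.ofReal_mul (by positivity), ← ENNReal.ofReal_mul (by positivity),
        ← ENNReal.ofReal_add (by positivity) (by positivity)]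
      refine ENNReal.ofReal_le_ofReal ?_
      have hpic := mul_le_mul_of_nonneg_right (picone hp hβ hr (v x) (v y))
        (show 0 ≤ (‖x - y‖ ^ ((N : ℝ) + s * p))⁻¹ by positivity)
      rw [div_eq_mul_inv (|v x - v y| ^ p)]
      linarith
    · exact (measurable_lintegral_cone
        (by simp only [Function.uncurry_def]; fun_prop) δ).aemeasurable
  have hfin := setLIntegral_one_sub_rpow_lt_top (p := p) hN hσ hp hβ hδ
  rw [setLIntegral_radial_balance hβ] at h3 hfin
  rw [mul_add] at h3
  have h4 := (ENNReal.add_le_add_iff_left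
    (ENNReal.mul_lt_top hH (le_self_add.trans_lt hfin)).ne).1 h3
  calc _ = 2 * (H * ∫⁻ r in Iio δ, ENNReal.ofReal ((1 - r ^ β) ^ p)
        ∂radialMeasure N (s * p)) := by ring
    _ ≤ 2 * I := by gcongr
    _ ≤ _ := two_mul_lintegral_cone_le hvm s p hδ.le

theorem hardy_inequality (hN : N ≠ 0) {s p β : ℝ} (hσ : 0 < s * p) (hσp : s * p < p) (hp : 1 ≤ p)
    (hβ : 0 < β) (hβp : β * p = (N : ℝ) - s * p) {v : EuclideanSpace ℝ (Fin N) → ℝ}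
    (hv : IsTestFunction v) :
    2 * radialConstant N (s * p) p β * hardyIntegral s p v ≤ gagliardoIntegral s p v := by
  have hH := hv.hardyIntegral_lt_top (s := s) (p := p) (by linarith) hσ.le
  have hJ := radialConstant_lt_top hN hσ hσp hβ
  have hlim := ENNReal.Tendsto.mul_const (ENNReal.Tendsto.const_mul
    (tendsto_setLIntegral_radialMeasure (by fun_prop) hJ) (Or.inr (ENNReal.ofNat_ne_top (n := 2))))
    (Or.inr hH.ne)
  refine le_of_tendsto hlim ?_
  filter_upwards [self_mem_nhdsWithin] with ε (hε : 0 < ε)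
  exact truncated_hardy hN hσ hp hβ hβp hv (by linarith)

end

/-! ### Sharpness -/

section

variable {N : ℕ} {β p n : ℝ}

theorem sphereArea_pos (hN : N ≠ 0) : 0 < sphereArea N := by
  have : Nonempty (Fin N) := ⟨⟨0, Nat.pos_of_ne_zero hN⟩⟩
  rw [sphereArea, Measure.toSphere_real_apply_univ, finrank_euclideanSpace_fin]
  have h1 : 0 < (N : ℝ) := by exact_mod_cast Nat.pos_of_ne_zero hN
  exact mul_pos h1 (ENNReal.toReal_pos (Metric.measure_ball_pos _ _ one_pos).ne'
    measure_ball_lt_top.ne)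

/-- The measure `|x|^{-N} dx` is invariant under dilations; in the variable `log |x|` it is a
multiple of Lebesgue measure. -/
theorem lintegral_log_shell (hN : N ≠ 0) {a : ℝ} (ha : 0 ≤ a) :
    ∫⁻ x : EuclideanSpace ℝ (Fin N) in {x | |Real.log ‖x‖| ≤ a}, ENNReal.ofReal (‖x‖ ^ (-(N : ℝ))) =
      ENNReal.ofReal (sphereArea N) * ENNReal.ofReal (2 * a) := by
  have hS : MeasurableSet {r : ℝ | |Real.log r| ≤ a} :=
    measurableSet_le (by fun_prop) measurable_const
  rw [← lintegral_indicator (measurableSet_le (by fun_prop) measurable_const)]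
  have h := lintegral_fun_norm hN (f := {r : ℝ | |Real.log r| ≤ a}.indicator
    fun r => ENNReal.ofReal (r ^ (-(N : ℝ)))) ((by fun_prop :
      Measurable fun r : ℝ => ENNReal.ofReal (r ^ (-(N : ℝ)))).indicator hS)
  refine Eq.trans (lintegral_congr fun x => ?_) (h.trans ?_)
  · simp only [indicator, mem_ofPred_eq]
  congr 1
  have hle : Real.exp (-a) ≤ Real.exp a := Real.exp_le_exp.2 (by linarith)
  have h1 : ∀ r ∈ Ioi (0 : ℝ), ENNReal.ofReal (r ^ (N - 1)) * {r : ℝ | |Real.log r| ≤ a}.indicator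
      (fun r => ENNReal.ofReal (r ^ (-(N : ℝ)))) r =
      (Icc (Real.exp (-a)) (Real.exp a)).indicator (fun r => ENNReal.ofReal r⁻¹) r := by
    intro r (hr : 0 < r)
    have hiff : |Real.log r| ≤ a ↔ r ∈ Icc (Real.exp (-a)) (Real.exp a) := by
      rw [abs_le, Real.le_log_iff_exp_le hr, Real.log_le_iff_le_exp hr, mem_Icc]
    simp only [indicator, mem_ofPred_eq, hiff]
    split_ifs
    · rw [← ENNReal.ofReal_mul (by positivity), ← Real.rpow_natCast, ← Real.rpow_add hr,
        Nat.cast_sub (Nat.one_le_iff_ne_zero.2 hN), ← Real.rpow_neg_one]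
      congr 2
      push_cast; ring
    · simp
  rw [setLIntegral_congr_fun measurableSet_Ioi h1, lintegral_indicator measurableSet_Icc,
    Measure.restrict_restrict measurableSet_Icc, inter_eq_left.2
      (fun r hr => mem_Ioi.2 ((Real.exp_pos _).trans_le hr.1)), ← restrict_Ioc_eq_restrict_Icc,
    ← ofReal_integral_eq_lintegral_ofReal, ← intervalIntegral.integral_of_le hle,
    integral_inv_of_pos (Real.exp_pos _) (Real.exp_pos _), Real.log_div (Real.exp_pos _).ne'
      (Real.exp_pos _).ne', Real.log_exp, Real.log_exp]
  · congr 1; ring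
  · have : IntervalIntegrable (fun r : ℝ => r⁻¹) volume (Real.exp (-a)) (Real.exp a) :=
      intervalIntegral.intervalIntegrable_inv (fun r hr => by
        rw [uIcc_of_le hle] at hr
        exact ((Real.exp_pos _).trans_le hr.1).ne') continuousOn_id
    exact (intervalIntegrable_iff_integrableOn_Ioc_of_le hle).1 this
  · filter_upwards [ae_restrict_mem measurableSet_Ioc] with r hr
    exact inv_nonneg.2 ((Real.exp_pos _).trans hr.1).le

/-- For a radial function the numerator vanishes on `|x| = |y|`, so the cone and its reflection
carry the whole integral. -/
theorem gagliardoIntegral_le_of_radial {s : ℝ} (hp : p ≠ 0)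
    {v : EuclideanSpace ℝ (Fin N) → ℝ} (hv : Measurable v)
    (hrad : ∀ x y, ‖x‖ = ‖y‖ → v x = v y) :
    gagliardoIntegral s p v ≤ 2 * ∫⁻ x, ∫⁻ y in {y | ‖y‖ < 1 * ‖x‖},
      ENNReal.ofReal (|v x - v y| ^ p / ‖x - y‖ ^ ((N : ℝ) + s * p)) := by
  have hg := measurable_gagliardo_integrand hv p ((N : ℝ) + s * p)
  rw [two_mul]
  nth_rw 1 [← lintegral_cone_gagliardo_swap hv]
  rw [← lintegral_add_left (measurable_lintegral_cone_swap hg 1)]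
  refine lintegral_mono fun x => ?_
  rw [← lintegral_indicator (measurableSet_lt (by fun_prop) (by fun_prop)),
    ← lintegral_indicator (measurableSet_lt (by fun_prop) (by fun_prop)),
    ← lintegral_add_left ((by fun_prop : Measurable fun y => ENNReal.ofReal
      (|v x - v y| ^ p / ‖x - y‖ ^ ((N : ℝ) + s * p))).indicator
        (measurableSet_lt (by fun_prop) (by fun_prop)))]
  refine lintegral_mono fun y => ?_
  simp only [indicator, mem_ofPred_eq, one_mul]
  rcases lt_trichotomy ‖x‖ ‖y‖ with h | h | h
  · rw [if_pos h]; exact le_self_add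
  · simp [hrad x y h, hp]
  · rw [if_pos h]; exact le_add_self

/-- The virtual ground state `|x|^{-β}`, cut off on a logarithmic scale of length `n`. -/
def trialFunction (N : ℕ) (β n : ℝ) (χ : ContDiffBump (0 : ℝ)) (x : EuclideanSpace ℝ (Fin N)) : ℝ :=
  ‖x‖ ^ (-β) * χ (Real.log ‖x‖ / n)

theorem trialFunction_eq_zero (hn : 0 < n) {χ : ContDiffBump (0 : ℝ)} {x : EuclideanSpace ℝ (Fin N)}
    (hx : n * χ.rOut ≤ |Real.log ‖x‖|) : trialFunction N β n χ x = 0 := by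
  rw [trialFunction, χ.zero_of_le_dist, mul_zero]
  rw [Real.dist_eq, sub_zero, abs_div, abs_of_pos hn, le_div_iff₀ hn]
  linarith

/-- Near the origin the function vanishes: the cutoff is `0` where `log |x|` is very negative, and
at the origin itself, where `log 0 = 0`, the factor `0 ^ (-β)` is `0`. -/
theorem isTestFunction_trialFunction (hβ : β ≠ 0) (hn : 0 < n) (χ : ContDiffBump (0 : ℝ)) :
    IsTestFunction (trialFunction N β n χ) := by
  set R := n * χ.rOut with hR
  have hsupp : ∀ x : EuclideanSpace ℝ (Fin N), trialFunction N β n χ x ≠ 0 →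
      ‖x‖ ∈ Icc (Real.exp (-R)) (Real.exp R) := by
    intro x hx
    have hx0 : 0 < ‖x‖ := by
      rw [norm_pos_iff]
      rintro rfl
      exact hx (by simp [trialFunction, Real.zero_rpow (neg_ne_zero.2 hβ)])
    have hlog : |Real.log ‖x‖| < R := by
      by_contra hcon
      exact hx (trialFunction_eq_zero hn (not_lt.1 hcon))
    rw [abs_lt] at hlog
    exact ⟨((Real.lt_log_iff_exp_lt hx0).1 hlog.1).le, ((Real.log_lt_iff_lt_exp hx0).1 hlog.2).le⟩
  have hclosed : IsClosed {x : EuclideanSpace ℝ (Fin N) |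
      ‖x‖ ∈ Icc (Real.exp (-R)) (Real.exp R)} := isClosed_Icc.preimage continuous_norm
  have htsupp : tsupport (trialFunction N β n χ) ⊆ {x | ‖x‖ ∈ Icc (Real.exp (-R)) (Real.exp R)} :=
    closure_minimal (fun x hx => hsupp x hx) hclosed
  have h0 : (0 : EuclideanSpace ℝ (Fin N)) ∉ tsupport (trialFunction N β n χ) := by
    intro h
    have h1 : Real.exp (-R) ≤ ‖(0 : EuclideanSpace ℝ (Fin N))‖ := (htsupp h).1
    rw [norm_zero] at h1
    exact absurd h1 (not_le.2 (Real.exp_pos _))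
  refine ⟨?_, ?_, h0⟩
  · rw [contDiff_iff_contDiffAt]
    intro x
    rcases eq_or_ne x 0 with rfl | hx
    · have : trialFunction N β n χ =ᶠ[𝓝 0] fun _ => 0 := notMem_tsupport_iff_eventuallyEq.1 h0
      exact contDiffAt_const.congr_of_eventuallyEq this
    · have hnorm : ContDiffAt ℝ ∞ (fun x : EuclideanSpace ℝ (Fin N) => ‖x‖) x :=
        contDiffAt_norm ℝ hx
      have hx' : ‖x‖ ≠ 0 := norm_ne_zero_iff.2 hx
      refine (hnorm.rpow_const_of_ne hx').mul ?_
      exact χ.contDiff.contDiffAt.comp x ((hnorm.log hx').div_const n)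
  · refine HasCompactSupport.of_support_subset_isCompact
      (isCompact_closedBall (0 : EuclideanSpace ℝ (Fin N)) (Real.exp R)) fun x hx => ?_
    simpa using (hsupp x hx).2

/-- The pointwise estimate behind the upper bound for the energy of the trial functions: the main
term comes from the variation of `|x|^{-β}`, the error term from that of the cutoff. -/
theorem abs_trialFunction_sub_rpow_le (hp : 1 ≤ p) (hβ : 0 < β) (hn : 0 < n)
    {χ : ContDiffBump (0 : ℝ)} {L : NNReal} (hL : LipschitzWith L χ) {l : ℝ}
    (hl : l ∈ Ioo (0 : ℝ) 1) {x y : EuclideanSpace ℝ (Fin N)} (hy : 0 < ‖y‖) (hyx : ‖y‖ < ‖x‖) :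
    |trialFunction N β n χ x - trialFunction N β n χ y| ^ p ≤
      (1 - l) ^ (1 - p) * (((‖y‖ / ‖x‖) ^ (-β) - 1) ^ p * |trialFunction N β n χ x| ^ p) +
      l ^ (1 - p) * (L / n) ^ p * (|Real.log (‖y‖ / ‖x‖)| ^ p * ‖y‖ ^ (-(β * p))) := by
  have hx : 0 < ‖x‖ := hy.trans hyx
  have hp0 : 0 ≤ p := by linarith
  set r := ‖y‖ / ‖x‖ with hr
  have hr0 : 0 < r := by positivity
  have hr1 : r < 1 := (div_lt_one hx).2 hyx
  have hu : 0 ≤ r ^ (-β) - 1 := by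
    have := Real.one_lt_rpow_of_pos_of_lt_one_of_neg hr0 hr1 (neg_neg_of_pos hβ)
    linarith
  have hyr : ‖y‖ ^ (-β) = r ^ (-β) * ‖x‖ ^ (-β) := by
    rw [← Real.mul_rpow hr0.le hx.le, hr, div_mul_cancel₀ _ hx.ne']
  have hsplit : trialFunction N β n χ x - trialFunction N β n χ y =
      -(r ^ (-β) - 1) * trialFunction N β n χ x +
        ‖y‖ ^ (-β) * (χ (Real.log ‖x‖ / n) - χ (Real.log ‖y‖ / n)) := by
    simp only [trialFunction, hyr]
    ring
  have hχ : |χ (Real.log ‖x‖ / n) - χ (Real.log ‖y‖ / n)| ≤ L / n * |Real.log r| := by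
    have := hL.dist_le_mul (Real.log ‖x‖ / n) (Real.log ‖y‖ / n)
    rw [Real.dist_eq, Real.dist_eq, ← sub_div, abs_div, abs_of_pos hn, abs_sub_comm (Real.log ‖x‖),
      ← Real.log_div hy.ne' hx.ne'] at this
    refine this.trans (le_of_eq ?_)
    ring
  rw [hsplit]
  refine (abs_add_rpow_le hp hl _ _).trans ?_
  rw [abs_mul, abs_mul, abs_neg, abs_of_nonneg hu, Real.mul_rpow hu (abs_nonneg _),
    Real.mul_rpow (abs_nonneg _) (abs_nonneg _), abs_of_pos (Real.rpow_pos_of_pos hy _),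
    ← Real.rpow_mul hy.le, neg_mul]
  have hpow : |χ (Real.log ‖x‖ / n) - χ (Real.log ‖y‖ / n)| ^ p ≤
      (L / n) ^ p * |Real.log r| ^ p := by
    rw [← Real.mul_rpow (by positivity) (abs_nonneg _)]
    exact Real.rpow_le_rpow (abs_nonneg _) hχ hp0
  have h3 : l ^ (1 - p) * (‖y‖ ^ (-(β * p)) *
        |χ (Real.log ‖x‖ / n) - χ (Real.log ‖y‖ / n)| ^ p) ≤
      l ^ (1 - p) * (‖y‖ ^ (-(β * p)) * ((L / n) ^ p * |Real.log r| ^ p)) := by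
    have := hl.1
    gcongr
  linarith

/-- The weight `|x|^{-α}` restricted to the shell `|log |x|| ≤ R`. -/
def shellWeight (N : ℕ) (α R : ℝ) : EuclideanSpace ℝ (Fin N) → ℝ≥0∞ :=
  {x | |Real.log ‖x‖| ≤ R}.indicator fun x => ENNReal.ofReal (‖x‖ ^ (-α))

@[fun_prop]
theorem measurable_shellWeight (N : ℕ) (α R : ℝ) : Measurable (shellWeight N α R) :=
  (by fun_prop : Measurable fun x : EuclideanSpace ℝ (Fin N) =>
    ENNReal.ofReal (‖x‖ ^ (-α))).indicator (measurableSet_le (by fun_prop) measurable_const)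

theorem lintegral_shellWeight (hN : N ≠ 0) {α σ R : ℝ} (hα : α = (N : ℝ) - σ) (hR : 0 ≤ R) :
    ∫⁻ x, shellWeight N α R x * ENNReal.ofReal (‖x‖ ^ (-σ)) =
      ENNReal.ofReal (sphereArea N) * ENNReal.ofReal (2 * R) := by
  rw [← lintegral_log_shell hN hR,
    ← lintegral_indicator (measurableSet_le (by fun_prop) measurable_const)]
  refine lintegral_congr_ae ?_
  filter_upwards [ae_ne_zero hN] with x hx
  have hx0 : 0 < ‖x‖ := norm_pos_iff.2 hx
  simp only [shellWeight, indicator, mem_ofPred_eq]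
  split_ifs
  · rw [← ENNReal.ofReal_mul (by positivity), ← Real.rpow_add hx0, hα]
    congr 2
    ring
  · simp

/-- The estimate of `abs_trialFunction_sub_rpow_le` against the kernel. The error term is needed
only where one of the two points lies in the shell that contains the support, and it is attributed
to that point. -/
theorem ofReal_trialFunction_le {q : ℝ} (hp : 1 ≤ p) (hβ : 0 < β) (hn : 0 < n)
    {χ : ContDiffBump (0 : ℝ)} {L : NNReal} (hL : LipschitzWith L χ) {l : ℝ}
    (hl : l ∈ Ioo (0 : ℝ) 1) {x y : EuclideanSpace ℝ (Fin N)} (hy : 0 < ‖y‖) (hyx : ‖y‖ < ‖x‖) :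
    ENNReal.ofReal (|trialFunction N β n χ x - trialFunction N β n χ y| ^ p / ‖x - y‖ ^ q) ≤
      ENNReal.ofReal ((1 - l) ^ (1 - p)) * (ENNReal.ofReal (|trialFunction N β n χ x| ^ p) *
        (ENNReal.ofReal (((‖y‖ / ‖x‖) ^ (-β) - 1) ^ p) * ENNReal.ofReal ((‖x - y‖ ^ q)⁻¹))) +
      ENNReal.ofReal (l ^ (1 - p) * (L / n) ^ p) *
        (shellWeight N (β * p) (n * χ.rOut) x * (ENNReal.ofReal (|Real.log (‖y‖ / ‖x‖)| ^ p *
            (‖y‖ / ‖x‖) ^ (-(β * p))) * ENNReal.ofReal ((‖x - y‖ ^ q)⁻¹)) +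
          shellWeight N (β * p) (n * χ.rOut) y * (ENNReal.ofReal (|Real.log (‖y‖ / ‖x‖)| ^ p) *
            ENNReal.ofReal ((‖x - y‖ ^ q)⁻¹))) := by
  have hl0 := hl.1
  have hl1 : 0 < 1 - l := sub_pos.2 hl.2
  have hx : 0 < ‖x‖ := hy.trans hyx
  have hest := abs_trialFunction_sub_rpow_le hp hβ hn hL hl hy hyx
  have hyr : ‖y‖ ^ (-(β * p)) = ‖x‖ ^ (-(β * p)) * (‖y‖ / ‖x‖) ^ (-(β * p)) := by
    rw [← Real.mul_rpow hx.le (by positivity), mul_div_cancel₀ _ hx.ne']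
  have hu : 0 ≤ (‖y‖ / ‖x‖) ^ (-β) - 1 := by
    have := Real.one_lt_rpow_of_pos_of_lt_one_of_neg (div_pos hy hx) ((div_lt_one hx).2 hyx)
      (neg_neg_of_pos hβ)
    linarith
  by_cases hmem : |Real.log ‖x‖| ≤ n * χ.rOut ∨ |Real.log ‖y‖| ≤ n * χ.rOut
  · generalize hk : ENNReal.ofReal ((‖x - y‖ ^ q)⁻¹) = k
    have hlow : ENNReal.ofReal (|Real.log (‖y‖ / ‖x‖)| ^ p * ‖y‖ ^ (-(β * p))) * k ≤
        shellWeight N (β * p) (n * χ.rOut) x * (ENNReal.ofReal (|Real.log (‖y‖ / ‖x‖)| ^ p *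
            (‖y‖ / ‖x‖) ^ (-(β * p))) * k) +
          shellWeight N (β * p) (n * χ.rOut) y *
            (ENNReal.ofReal (|Real.log (‖y‖ / ‖x‖)| ^ p) * k) := by
      rcases hmem with hxA | hyA
      · refine le_trans (le_of_eq ?_) le_self_add
        have hw : shellWeight N (β * p) (n * χ.rOut) x = ENNReal.ofReal (‖x‖ ^ (-(β * p))) :=
          indicator_of_mem (s := {x | |Real.log ‖x‖| ≤ n * χ.rOut}) hxA _
        rw [hw, hyr, ENNReal.ofReal_mul (by positivity), ENNReal.ofReal_mul (by positivity),
          ENNReal.ofReal_mul (by positivity)]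
        ring
      · refine le_trans (le_of_eq ?_) le_add_self
        have hw : shellWeight N (β * p) (n * χ.rOut) y = ENNReal.ofReal (‖y‖ ^ (-(β * p))) :=
          indicator_of_mem (s := {x | |Real.log ‖x‖| ≤ n * χ.rOut}) hyA _
        rw [hw, ENNReal.ofReal_mul (by positivity)]
        ring
    rw [div_eq_mul_inv, ENNReal.ofReal_mul (by positivity), hk]
    refine (mul_le_mul' (ENNReal.ofReal_le_ofReal hest) le_rfl).trans ?_
    rw [ENNReal.ofReal_add (by positivity) (by positivity), ENNReal.ofReal_mul (by positivity),
      ENNReal.ofReal_mul (by positivity),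
      ENNReal.ofReal_mul (p := l ^ (1 - p) * (L / n) ^ p) (by positivity), add_mul]
    refine add_le_add (le_of_eq (by ring)) ?_
    rw [mul_assoc]
    exact mul_le_mul' le_rfl hlow
  · push Not at hmem
    rw [trialFunction_eq_zero hn hmem.1.le, trialFunction_eq_zero hn hmem.2.le, sub_zero, abs_zero,
      Real.zero_rpow (by linarith), zero_div, ENNReal.ofReal_zero]
    exact zero_le

theorem lintegral_cone_combination
    {T₁ T₂ T₃ : EuclideanSpace ℝ (Fin N) → EuclideanSpace ℝ (Fin N) → ℝ≥0∞}
    (h₁ : Measurable (Function.uncurry T₁)) (h₂ : Measurable (Function.uncurry T₂))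
    (h₃ : Measurable (Function.uncurry T₃)) (a b : ℝ≥0∞) (δ : ℝ) :
    ∫⁻ x, ∫⁻ y in {y | ‖y‖ < δ * ‖x‖}, (a * T₁ x y + b * (T₂ x y + T₃ x y)) =
      a * (∫⁻ x, ∫⁻ y in {y | ‖y‖ < δ * ‖x‖}, T₁ x y) +
        b * ((∫⁻ x, ∫⁻ y in {y | ‖y‖ < δ * ‖x‖}, T₂ x y) +
          ∫⁻ x, ∫⁻ y in {y | ‖y‖ < δ * ‖x‖}, T₃ x y) := by
  have c₁ := measurable_lintegral_cone h₁ δ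
  have c₂ := measurable_lintegral_cone h₂ δ
  have c₃ := measurable_lintegral_cone h₃ δ
  have c₂₃ : Measurable fun x => (∫⁻ y in {y | ‖y‖ < δ * ‖x‖}, T₂ x y) +
      ∫⁻ y in {y | ‖y‖ < δ * ‖x‖}, T₃ x y := c₂.add c₃
  rw [← lintegral_add_left c₂, ← lintegral_const_mul _ c₁, ← lintegral_const_mul _ c₂₃,
    ← lintegral_add_left (c₁.const_mul a)]
  refine lintegral_congr fun x => ?_
  have m₁ : Measurable fun y => T₁ x y := h₁.comp measurable_prodMk_left
  have m₂ : Measurable fun y => T₂ x y := h₂.comp measurable_prodMk_left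
  have m₂₃ : Measurable fun y => T₂ x y + T₃ x y :=
    m₂.add (h₃.comp measurable_prodMk_left)
  rw [lintegral_add_left (m₁.const_mul _), lintegral_const_mul _ m₁,
    lintegral_const_mul _ m₂₃, lintegral_add_left m₂]

theorem gagliardoIntegral_trialFunction_le (hN : N ≠ 0) {s : ℝ} (hp : 1 ≤ p)
    (hβ : 0 < β) (hβp : β * p = (N : ℝ) - s * p) (hn : 0 < n)
    {χ : ContDiffBump (0 : ℝ)} {L : NNReal} (hL : LipschitzWith L χ) {l : ℝ}
    (hl : l ∈ Ioo (0 : ℝ) 1) :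
    gagliardoIntegral s p (trialFunction N β n χ) ≤
      2 * (ENNReal.ofReal ((1 - l) ^ (1 - p)) *
          (hardyIntegral s p (trialFunction N β n χ) * radialConstant N (s * p) p β) +
        ENNReal.ofReal (l ^ (1 - p) * (L / n) ^ p) * (2 *
          (ENNReal.ofReal (sphereArea N) * ENNReal.ofReal (2 * (n * χ.rOut)) *
            ∫⁻ r, ENNReal.ofReal (|Real.log r| ^ p) ∂radialMeasure N (s * p)))) := by
  have hrO := χ.rOut_pos
  have hvm : Measurable (trialFunction N β n χ) :=
    (isTestFunction_trialFunction hβ.ne' hn χ).1.continuous.measurable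
  have hmass := lintegral_shellWeight (R := n * χ.rOut) hN hβp (by positivity)
  have i1 := lintegral_cone_outer_weight (σ := s * p) hN le_rfl
    (w := fun x => ENNReal.ofReal (|trialFunction N β n χ x| ^ p)) (by fun_prop)
    (F := fun r => ENNReal.ofReal ((r ^ (-β) - 1) ^ p)) (by fun_prop)
  have i2 := lintegral_cone_outer_weight (σ := s * p) hN le_rfl
    (measurable_shellWeight N (β * p) (n * χ.rOut))
    (F := fun r => ENNReal.ofReal (|Real.log r| ^ p * r ^ (-(β * p)))) (by fun_prop)
  have i3 := lintegral_cone_inner_weight (σ := s * p) hN le_rfl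
    (measurable_shellWeight N (β * p) (n * χ.rOut))
    (F := fun r => ENNReal.ofReal (|Real.log r| ^ p)) (by fun_prop)
  have hIio : ∀ F : ℝ → ℝ≥0∞, ∫⁻ r in Iio (1 : ℝ), F r ∂radialMeasure N (s * p) =
      ∫⁻ r, F r ∂radialMeasure N (s * p) := by
    intro F
    rw [Measure.restrict_eq_self_of_ae_mem]
    filter_upwards [ae_radialMeasure N (s * p)] with r hr using hr.2
  rw [← hardyIntegral_eq, hIio] at i1
  rw [hmass, hIio] at i2 i3
  have e1 : ∫⁻ r, ENNReal.ofReal ((r ^ (-β) - 1) ^ p) * ENNReal.ofReal (r ^ ((N : ℝ) - s * p))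
      ∂radialMeasure N (s * p) = radialConstant N (s * p) p β := by
    refine lintegral_congr_ae ?_
    filter_upwards [ae_radialMeasure N (s * p)] with r hr
    have h0 := hr.1
    have h1 := (one_sub_rpow_mem hβ hr).1
    rw [← ENNReal.ofReal_mul' (by positivity), show r ^ (-β) - 1 = r ^ (-β) * (1 - r ^ β) by
      rw [mul_sub, ← Real.rpow_add h0]; simp, Real.mul_rpow (by positivity) h1.le,
      ← Real.rpow_mul h0.le, mul_right_comm, ← Real.rpow_add h0, ← hβp, neg_mul, neg_add_cancel,
      Real.rpow_zero, one_mul]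
  have e2 : ∫⁻ r, ENNReal.ofReal (|Real.log r| ^ p * r ^ (-(β * p))) *
        ENNReal.ofReal (r ^ ((N : ℝ) - s * p)) ∂radialMeasure N (s * p) =
      ∫⁻ r, ENNReal.ofReal (|Real.log r| ^ p) ∂radialMeasure N (s * p) := by
    refine lintegral_congr_ae ?_
    filter_upwards [ae_radialMeasure N (s * p)] with r hr
    have h0 := hr.1
    rw [← ENNReal.ofReal_mul' (by positivity), mul_assoc, ← Real.rpow_add h0, ← hβp,
      neg_add_cancel, Real.rpow_zero, mul_one]
  rw [e1] at i1
  rw [e2] at i2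
  rw [two_mul (ENNReal.ofReal (sphereArea N) * _ * _)]
  nth_rw 1 [← i2]
  rw [← i1, ← i3, ← lintegral_cone_combination (by simp only [Function.uncurry_def]; fun_prop)
    (by simp only [Function.uncurry_def]; fun_prop) (by simp only [Function.uncurry_def]; fun_prop)]
  refine (gagliardoIntegral_le_of_radial (by linarith) hvm fun x y h => by
    simp only [trialFunction, h]).trans (mul_le_mul' le_rfl ?_)
  refine lintegral_mono fun x => lintegral_mono_ae ?_
  filter_upwards [ae_restrict_mem (measurableSet_lt (by fun_prop) (by fun_prop)),
    ae_restrict_of_ae (ae_ne_zero hN)] with y (hy : ‖y‖ < 1 * ‖x‖) hy0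
  exact ofReal_trialFunction_le hp hβ hn hL hl (norm_pos_iff.2 hy0) (by simpa using hy)

theorem le_hardyIntegral_trialFunction (hN : N ≠ 0) {s : ℝ}
    (hβp : β * p = (N : ℝ) - s * p) (hn : 0 < n) (χ : ContDiffBump (0 : ℝ)) :
    ENNReal.ofReal (sphereArea N) * ENNReal.ofReal (2 * (n * χ.rIn)) ≤
      hardyIntegral s p (trialFunction N β n χ) := by
  have hrI := χ.rIn_pos
  have hAm : MeasurableSet {x : EuclideanSpace ℝ (Fin N) | |Real.log ‖x‖| ≤ n * χ.rIn} :=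
    measurableSet_le (by fun_prop) measurable_const
  rw [← lintegral_log_shell hN (by positivity), hardyIntegral_eq]
  refine le_trans (le_of_eq ?_) (setLIntegral_le_lintegral
    {x : EuclideanSpace ℝ (Fin N) | |Real.log ‖x‖| ≤ n * χ.rIn} _)
  refine lintegral_congr_ae ?_
  filter_upwards [ae_restrict_mem hAm, ae_restrict_of_ae (ae_ne_zero hN)] with x hx hx0
  have hx0 : 0 < ‖x‖ := norm_pos_iff.2 hx0
  have hx : |Real.log ‖x‖| ≤ n * χ.rIn := hx
  have h1 : χ (Real.log ‖x‖ / n) = 1 := by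
    refine χ.one_of_mem_closedBall ?_
    rw [mem_closedBall_zero_iff, Real.norm_eq_abs, abs_div, abs_of_pos hn, div_le_iff₀ hn]
    linarith
  rw [trialFunction, h1, mul_one, abs_of_pos (by positivity), ← Real.rpow_mul hx0.le, neg_mul, hβp,
    ← ENNReal.ofReal_mul (by positivity), ← Real.rpow_add hx0]
  congr 2
  ring

/-- Sharpness: letting first `n → ∞` and then `l → 0`, the quotient of the two functionals at the
trial functions tends to at most twice the radial constant. -/
theorem le_of_hardy_inequality (hN : N ≠ 0) {s : ℝ} (hσ : 0 < s * p) (hσp : s * p < p)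
    (hp : 1 ≤ p) (hβ : 0 < β) (hβp : β * p = (N : ℝ) - s * p) {K : ℝ≥0∞}
    (hK : ∀ v : EuclideanSpace ℝ (Fin N) → ℝ, IsTestFunction v →
      K * hardyIntegral s p v ≤ gagliardoIntegral s p v) :
    K ≤ 2 * radialConstant N (s * p) p β := by
  have hp0 : 0 < p := by linarith
  -- The ratio `2` of the radii bounds the mass of the shell by twice the Hardy integral.
  set χ : ContDiffBump (0 : ℝ) := ⟨1, 2, one_pos, one_lt_two⟩ with hχ
  obtain ⟨L, hL⟩ := (χ.contDiff (n := 1)).lipschitzWith_of_hasCompactSupport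
    χ.hasCompactSupport one_ne_zero
  set J := radialConstant N (s * p) p β
  have hJ : J < ⊤ := radialConstant_lt_top hN hσ hσp hβ
  set Q := ∫⁻ r, ENNReal.ofReal (|Real.log r| ^ p) ∂radialMeasure N (s * p)
  have hQ : Q < ⊤ := lintegral_log_lt_top hN hσ hσp
  have hbound : ∀ n : ℝ, 0 < n → ∀ l ∈ Ioo (0 : ℝ) 1,
      K ≤ 2 * (ENNReal.ofReal ((1 - l) ^ (1 - p)) * J +
        ENNReal.ofReal (l ^ (1 - p) * (L / n) ^ p) * (4 * Q)) := by
    intro n hn l hl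
    have hv := isTestFunction_trialFunction (N := N) hβ.ne' hn χ
    have hH := hv.hardyIntegral_lt_top (s := s) hp0 hσ.le
    have hlow := le_hardyIntegral_trialFunction (s := s) hN hβp hn χ
    have hup := gagliardoIntegral_trialFunction_le hN hp hβ hβp hn hL hl
    set H := hardyIntegral s p (trialFunction N β n χ)
    have hH0 : H ≠ 0 := by
      intro h0
      rw [h0, nonpos_iff_eq_zero, mul_eq_zero, ENNReal.ofReal_eq_zero,
        ENNReal.ofReal_eq_zero] at hlow
      have := sphereArea_pos hN
      have := χ.rIn_pos
      rcases hlow with h | h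
      · linarith
      · have : 0 < 2 * (n * χ.rIn) := by positivity
        linarith
    have hmass : ENNReal.ofReal (sphereArea N) * ENNReal.ofReal (2 * (n * χ.rOut)) ≤ 2 * H := by
      refine le_trans (le_of_eq ?_) (mul_le_mul_right hlow 2)
      rw [show 2 * (n * χ.rOut) = 2 * (2 * (n * χ.rIn)) by simp only [hχ]; ring,
        ENNReal.ofReal_mul (p := 2) two_pos.le, ENNReal.ofReal_ofNat]
      ring
    refine (ENNReal.mul_le_mul_iff_left hH0 hH.ne).1 ((hK _ hv).trans (hup.trans ?_))
    calc _ ≤ 2 * (ENNReal.ofReal ((1 - l) ^ (1 - p)) * (H * J) +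
          ENNReal.ofReal (l ^ (1 - p) * (L / n) ^ p) * (2 * (2 * H * Q))) := by gcongr
      _ = _ := by ring
  have hn_lim : ∀ l ∈ Ioo (0 : ℝ) 1, K ≤ 2 * (ENNReal.ofReal ((1 - l) ^ (1 - p)) * J) := by
    intro l hl
    have h1 : Tendsto (fun n : ℝ => l ^ (1 - p) * (L / n) ^ p) atTop (𝓝 0) := by
      have h2 : Tendsto (fun n : ℝ => (L : ℝ) / n) atTop (𝓝 0) :=
        tendsto_const_nhds.div_atTop tendsto_id
      have h3 := (Real.continuousAt_rpow_const 0 p (Or.inr hp0.le)).tendsto.comp h2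
      rw [Real.zero_rpow hp0.ne'] at h3
      simpa using h3.const_mul (l ^ (1 - p))
    have h2 := (ENNReal.continuous_ofReal.tendsto 0).comp h1
    rw [ENNReal.ofReal_zero] at h2
    have h3 := ENNReal.Tendsto.mul_const h2 (b := 4 * Q)
      (Or.inr (ENNReal.mul_lt_top (by simp) hQ).ne)
    rw [zero_mul] at h3
    have h4 := ENNReal.Tendsto.const_mul (a := 2)
      (h3.const_add (ENNReal.ofReal ((1 - l) ^ (1 - p)) * J)) (Or.inr (by simp))
    rw [add_zero] at h4
    refine ge_of_tendsto h4 ?_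
    filter_upwards [eventually_gt_atTop 0] with n hn using hbound n hn l hl
  have h1 : Tendsto (fun l : ℝ => (1 - l) ^ (1 - p)) (𝓝[>] 0) (𝓝 1) := by
    have : ContinuousAt (fun l : ℝ => (1 - l) ^ (1 - p)) 0 :=
      (by fun_prop : ContinuousAt (fun l : ℝ => 1 - l) 0).rpow_const (Or.inl (by norm_num))
    simpa using this.tendsto.mono_left nhdsWithin_le_nhds
  have h2 := (ENNReal.continuous_ofReal.tendsto 1).comp h1
  rw [ENNReal.ofReal_one] at h2
  have h3 := ENNReal.Tendsto.const_mul (a := 2) (ENNReal.Tendsto.mul_const h2 (Or.inr hJ.ne))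
    (Or.inr (by simp))
  rw [one_mul] at h3
  refine ge_of_tendsto h3 ?_
  filter_upwards [Ioo_mem_nhdsGT one_pos] with l hl using hn_lim l hl

end

end FracHardy

end

theorem theorem6p3 (N : ℕ) (s p : ℝ) (hs0 : 0 < s) (hs1 : s < 1) (hp : 1 < p)
    (hsp : s * p < (N : ℝ)) :
    -- the explicit constant is positive
    0 < FracHardy.hardyConstant N s p ∧
    -- it is `C(β)` for `β = (N - sp)/p`
    (∀ x : EuclideanSpace ℝ (Fin N), ‖x‖ = 1 →
      Tendsto (FracHardy.truncatedC s p (((N : ℝ) - s * p) / p) x) (𝓝[>] 0)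
        (𝓝 (FracHardy.hardyConstant N s p))) ∧
    -- the Hardy inequality holds with it
    (∀ v : EuclideanSpace ℝ (Fin N) → ℝ, FracHardy.IsTestFunction v →
      ENNReal.ofReal (FracHardy.hardyConstant N s p) * FracHardy.hardyIntegral s p v ≤
        FracHardy.gagliardoIntegral s p v) ∧
    -- and no larger constant is admissible
    (∀ K : ℝ,
      (∀ v : EuclideanSpace ℝ (Fin N) → ℝ, FracHardy.IsTestFunction v →
        ENNReal.ofReal K * FracHardy.hardyIntegral s p v ≤ FracHardy.gagliardoIntegral s p v) →
      K ≤ FracHardy.hardyConstant N s p) := by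
  have hp0 : 0 < p := by linarith
  have hσ : 0 < s * p := by positivity
  have hσp : s * p < p := mul_lt_of_lt_one_left hp0 hs1
  have hN : N ≠ 0 := by
    rintro rfl
    rw [Nat.cast_zero] at hsp
    linarith
  have hβ : 0 < ((N : ℝ) - s * p) / p := div_pos (by linarith) hp0
  have hβp : ((N : ℝ) - s * p) / p * p = (N : ℝ) - s * p := div_mul_cancel₀ _ hp0.ne'
  have hJ := FracHardy.radialConstant_lt_top hN hσ hσp hβ
  have hC := FracHardy.hardyConstant_eq hN hσ hβ
  have hpos : 0 < FracHardy.hardyConstant N s p := by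
    rw [hC]
    exact mul_pos two_pos (ENNReal.toReal_pos (FracHardy.radialConstant_pos hN hβ).ne' hJ.ne)
  have hofReal : ENNReal.ofReal (FracHardy.hardyConstant N s p) =
      2 * FracHardy.radialConstant N (s * p) p (((N : ℝ) - s * p) / p) := by
    rw [hC, ENNReal.ofReal_mul two_pos.le, ENNReal.ofReal_toReal hJ.ne, ENNReal.ofReal_ofNat]
  refine ⟨hpos, fun x hx => ?_, fun v hv => ?_, fun K hK => ?_⟩
  · rw [hC]
    exact FracHardy.tendsto_truncatedC hN hσ hσp hp.le hβ hβp hx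
  · rw [hofReal]
    exact FracHardy.hardy_inequality hN hσ hσp hp.le hβ hβp hv
  · have h := FracHardy.le_of_hardy_inequality hN hσ hσp hp.le hβ hβp hK
    rwa [← hofReal, ENNReal.ofReal_le_ofReal_iff hpos.le] at h
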